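/- Let $M$ be a complex manifold of dimension $3$ with holomorphic tangent bundle $\mathcal T_M$, and let $(\mathcal T_M,h,\Phi,\kappa,\mathcal U,\mathcal Q)$ be a tt*-bundle. That is: - $h$ is a positive definite smooth Hermitian metric on $\mathcal T_M$ with Chern connection $D=D'+\bar\partial$; $\dagger$ denotes the $h$-adjoint; $\Phi$ is a holomorphic Higgs field ($\bar\partial\Phi=0$, $\Phi\wedge\Phi=0$) such that $D'+\bar\partial+\Phi+\Phi^\dagger$ is an integrable connection; - $\mathcal U,\mathcal Q$ are smooth endomorphisms of $\mathcal T_M$ with $\bar\partial(\mathcal U)=0$, $\mathcal Q^\dagger=\mathcal Q$, $[\Phi,\mathcal U]=0$, $D'(\mathcal U)-[\Phi,\mathcal Q]+\Phi=0$ and $D'(\mathcal Q)+[\Phi,\mathcal U^\dagger]=0$; - $\kappa$ is a smooth antilinear automorphism of $\mathcal T_M$ with $\kappa^2=\mathrm{Id}$, $h(\kappa\cdot,\kappa\cdot)=\overline{h(\cdot,\cdot)}$, $D(\kappa)=0$, and $\mathcal U^*=\mathcal U$, $\mathcal Q^*+\mathcal Q=0$, where $*$ is the adjoint with respect to $g(X,Y)=h(X,\kappa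 Y)$. Assume that $D'(\mathcal U)=0$, and let $p\in M$. The connection $D'$ is called holomorphic if $D'\bar\partial+\bar\partial D'=0$. 1. If none of $1,-1,\tfrac12,-\tfrac12$ is an eigenvalue of $\mathcal Q(p)$, then there is an open neighbourhood $U_p$ of $p$ such that $\Phi|_{U_p}=0$ and $D'|_{U_p}$ is holomorphic. 2. If one of $1,-1,\tfrac12,-\tfrac12$ is an eigenvalue of $\mathcal Q(p)$ and $D'$ is holomorphic on $M$, then on some open neighbourhood of $p$ one has $\Phi=0$ and there is a $D'$-flat holomorphic frame $X_1,X_2,X_3$ of $\mathcal T_M$ in which the matrix of $\mathcal Q$ is $\mathrm{diag}(-1,0,1)$ or $\mathrm{diag}(-\tfrac12,0,\tfrac12)$. 3. Suppose that, on some open neighbourhood of $p$, there is a $D'$-flat holomorphic frame in which the matrix of $\mathcal Q$ is $\mathrm{diag}(-1,0,1)$, and suppose moreover that $\mathcal U(p)=0$. Consider the restriction to $\{p\}\times\mathbb C^*$ of the structure connection $D'+\tfrac1z\Phi+\bigl(\tfrac{\mathcal U}{z}-\mathcal Q-z\,\mathcal U^\dagger\bigr)\tfrac{dz}{z}$, that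 is, the connection $\frac{d}{dz}+\frac{\mathcal U(p)}{z^2}-\frac{\mathcal Q(p)}{z}-\mathcal U(p)^\dagger$ on the trivial bundle with fibre $T_pM$ over $\mathbb C^*$. The monodromy representation of its local system of flat sections is trivial. -/

import Mathlib

open scoped Manifold ContDiff Matrix ComplexConjugate

noncomputable section

/-! ### Wirtinger derivatives on `ℂⁿ` -/

namespace TTStar

/-- `∂f/∂z_k = (∂f/∂x_k - i ∂f/∂y_k) / 2` for a (real differentiable) function on `ℂⁿ`. -/
def dz {n : ℕ} (k : Fin n) (f : (Fin n → ℂ) → ℂ) (z : Fin n → ℂ) : ℂ :=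
  (1 / 2) * (fderiv ℝ f z (Pi.single k 1) - Complex.I * fderiv ℝ f z (Pi.single k Complex.I))

/-- `∂f/∂z̄_k = (∂f/∂x_k + i ∂f/∂y_k) / 2`. -/
def dzbar {n : ℕ} (k : Fin n) (f : (Fin n → ℂ) → ℂ) (z : Fin n → ℂ) : ℂ :=
  (1 / 2) * (fderiv ℝ f z (Pi.single k 1) + Complex.I * fderiv ℝ f z (Pi.single k Complex.I))

/-- Entrywise `∂/∂z_k` of a matrix-valued function. -/
def mdz {n : ℕ} (k : Fin n) (A : (Fin n → ℂ) → Matrix (Fin n) (Fin n) ℂ) (z : Fin n → ℂ) :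
    Matrix (Fin n) (Fin n) ℂ :=
  Matrix.of fun i j => dz k (fun w => A w i j) z

/-- Entrywise `∂/∂z̄_k` of a matrix-valued function. -/
def mdzbar {n : ℕ} (k : Fin n) (A : (Fin n → ℂ) → Matrix (Fin n) (Fin n) ℂ) (z : Fin n → ℂ) :
    Matrix (Fin n) (Fin n) ℂ :=
  Matrix.of fun i j => dzbar k (fun w => A w i j) z

/-- A matrix-valued function on an open set of `ℂⁿ` is `C^∞` (in the real sense). -/
def MSmoothOn {n : ℕ} (A : (Fin n → ℂ) → Matrix (Fin n) (Fin n) ℂ) (s : Set (Fin n → ℂ)) : Prop :=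
  ∀ i j, ContDiffOn ℝ ∞ (fun z => A z i j) s

/-! ### Hermitian adjoints -/

/-- A positive definite Hermitian form on a finite dimensional space: every endomorphism has an
adjoint. -/
theorem exists_hermAdjoint {V : Type*} [AddCommGroup V] [Module ℂ V] [FiniteDimensional ℂ V]
    (h : V →ₗ[ℂ] V →ₗ⋆[ℂ] ℂ) (hs : ∀ v w, h v w = conj (h w v))
    (hp : ∀ v, v ≠ 0 → 0 < (h v v).re) (A : Module.End ℂ V) :
    ∃ B : Module.End ℂ V, ∀ v w, h (A v) w = h v (B w) := by
  let c : InnerProductSpace.Core ℂ V :=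
    { inner := fun x y => h y x
      conj_inner_symm := fun x y => (hs y x).symm
      re_inner_nonneg := fun x => by
        by_cases hx : x = 0
        · simp [hx]
        · exact (hp x hx).le
      add_left := fun x y z => by simp
      smul_left := fun x y r => by simp
      definite := fun x hx => by
        by_contra hne
        have := hp x hne
        rw [hx] at this
        simp at this }
  let _ : NormedAddCommGroup V := c.toNormedAddCommGroup
  let _ : InnerProductSpace ℂ V := InnerProductSpace.ofCore c.toCore
  refine ⟨LinearMap.adjoint A, fun v w => ?_⟩
  exact (LinearMap.adjoint_inner_left A v w).symm

open Classical in
/-- The adjoint `A†` of `A` with respect to `h`, i.e. `h (A v) w = h v (A† w)`. For a positive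
definite Hermitian form it exists (`exists_hermAdjoint`) and is unique. -/
def hermAdjoint {V : Type*} [AddCommGroup V] [Module ℂ V]
    (h : V →ₗ[ℂ] V →ₗ⋆[ℂ] ℂ) (A : Module.End ℂ V) : Module.End ℂ V :=
  if H : ∃ B : Module.End ℂ V, ∀ v w, h (A v) w = h v (B w) then H.choose else 0

/-! ### Local coordinate expressions on the holomorphic tangent bundle

`M` is a complex manifold of dimension `n`, and `TangentSpace 𝓘(ℂ, Fin n → ℂ) x` is its holomorphic
tangent space at `x`. For a holomorphic chart `e`, every object on `T_M` is expressed in the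
coordinate frame `∂_1, …, ∂_n` of `e`, as a function of the coordinate `z ∈ e.target`. -/

/-- The holomorphic tangent space at `x`. -/
abbrev HolTangent (n : ℕ) {M : Type*} [TopologicalSpace M] [ChartedSpace (Fin n → ℂ) M] (x : M) :
    Type :=
  TangentSpace 𝓘(ℂ, Fin n → ℂ) x

section Coordinates

variable {n : ℕ} {M : Type*} [TopologicalSpace M] [ChartedSpace (Fin n → ℂ) M]

/-- The coordinate vector `∂_k` of the chart `e` at the point with coordinate `z`. -/
def coordVec (e : OpenPartialHomeomorph M (Fin n → ℂ)) (z : Fin n → ℂ) (k : Fin n) :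
    HolTangent n (e.symm z) :=
  mfderiv 𝓘(ℂ, Fin n → ℂ) 𝓘(ℂ, Fin n → ℂ) e.symm z (Pi.single k (1 : ℂ) : Fin n → ℂ)

/-- The components, in the coordinate frame of `e`, of a tangent vector at the point with
coordinate `z`. -/
def comps (e : OpenPartialHomeomorph M (Fin n → ℂ)) (z : Fin n → ℂ)
    (v : HolTangent n (e.symm z)) : Fin n → ℂ :=
  mfderiv 𝓘(ℂ, Fin n → ℂ) 𝓘(ℂ, Fin n → ℂ) e (e.symm z) v

/-- The matrix of a field of endomorphisms of `T_M` in the coordinate frame. -/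
def endMat (e : OpenPartialHomeomorph M (Fin n → ℂ))
    (A : ∀ x : M, Module.End ℂ (HolTangent n x)) (z : Fin n → ℂ) : Matrix (Fin n) (Fin n) ℂ :=
  Matrix.of fun i j => comps e z (A (e.symm z) (coordVec e z j)) i

/-- The matrix `K` of a field `κ` of antilinear endomorphisms: `κ (∑ aⱼ ∂ⱼ) = ∑ (K ā)ᵢ ∂ᵢ`. -/
def antiMat (e : OpenPartialHomeomorph M (Fin n → ℂ))
    (κ : ∀ x : M, HolTangent n x →ₗ⋆[ℂ] HolTangent n x) (z : Fin n → ℂ) :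
    Matrix (Fin n) (Fin n) ℂ :=
  Matrix.of fun i j => comps e z (κ (e.symm z) (coordVec e z j)) i

/-- The Gram matrix `H i j = h(∂_j, ∂_i)`, so that `h(a, b) = b* H a` in components. -/
def gram (e : OpenPartialHomeomorph M (Fin n → ℂ))
    (h : ∀ x : M, HolTangent n x →ₗ[ℂ] HolTangent n x →ₗ⋆[ℂ] ℂ) (z : Fin n → ℂ) :
    Matrix (Fin n) (Fin n) ℂ :=
  Matrix.of fun i j => h (e.symm z) (coordVec e z j) (coordVec e z i)

/-- The matrix of `Φ_{∂_k}`. -/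
def higgsMat (e : OpenPartialHomeomorph M (Fin n → ℂ))
    (Φ : ∀ x : M, HolTangent n x →ₗ[ℂ] Module.End ℂ (HolTangent n x)) (k : Fin n)
    (z : Fin n → ℂ) : Matrix (Fin n) (Fin n) ℂ :=
  Matrix.of fun i j => comps e z (Φ (e.symm z) (coordVec e z k) (coordVec e z j)) i

/-- The matrix of the `h`-adjoint of `Φ_{∂_k}`, i.e. of the component along `dz̄_k` of the
`(0,1)`-form `Φ†`. -/
def higgsAdjMat (e : OpenPartialHomeomorph M (Fin n → ℂ))
    (h : ∀ x : M, HolTangent n x →ₗ[ℂ] HolTangent n x →ₗ⋆[ℂ] ℂ)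
    (Φ : ∀ x : M, HolTangent n x →ₗ[ℂ] Module.End ℂ (HolTangent n x)) (k : Fin n)
    (z : Fin n → ℂ) : Matrix (Fin n) (Fin n) ℂ :=
  Matrix.of fun i j => comps e z
    (hermAdjoint (h (e.symm z)) (Φ (e.symm z) (coordVec e z k)) (coordVec e z j)) i

/-- The connection matrix `θ_k` of the `(1,0)`-part `D'` of the Chern connection of `h` in the
holomorphic coordinate frame, `D'_{∂_k} s = ∂_k s + θ_k s`; compatibility
`∂_k h(a, b) = h(D'_k a, b) + h(a, ∂̄_k b)` gives `θ_k = H⁻¹ ∂_k H`. -/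
def chern (e : OpenPartialHomeomorph M (Fin n → ℂ))
    (h : ∀ x : M, HolTangent n x →ₗ[ℂ] HolTangent n x →ₗ⋆[ℂ] ℂ) (k : Fin n)
    (z : Fin n → ℂ) : Matrix (Fin n) (Fin n) ℂ :=
  (gram e h z)⁻¹ * mdz k (gram e h) z

/-- `D'_{∂_k}` of an endomorphism with matrix function `A`: `D'(A) s = D'(A s) - A (D' s)`. -/
def covEnd (e : OpenPartialHomeomorph M (Fin n → ℂ))
    (h : ∀ x : M, HolTangent n x →ₗ[ℂ] HolTangent n x →ₗ⋆[ℂ] ℂ) (k : Fin n)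
    (A : (Fin n → ℂ) → Matrix (Fin n) (Fin n) ℂ) (z : Fin n → ℂ) : Matrix (Fin n) (Fin n) ℂ :=
  mdz k A z + chern e h k z * A z - A z * chern e h k z

end Coordinates

/-! ### tt*-bundles on the holomorphic tangent bundle -/

/-- A positive definite `C^∞` Hermitian metric on the holomorphic tangent bundle of `M`. -/
structure HermitianMetric (n : ℕ) (M : Type*) [TopologicalSpace M]
    [ChartedSpace (Fin n → ℂ) M] where
  /-- the metric, linear in the first and antilinear in the second variable -/
  h : ∀ x : M, HolTangent n x →ₗ[ℂ] HolTangent n x →ₗ⋆[ℂ] ℂ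
  h_symm : ∀ x v w, h x v w = conj (h x w v)
  h_pos : ∀ x v, v ≠ 0 → 0 < (h x v v).re
  h_smooth : ∀ e ∈ atlas (Fin n → ℂ) M, MSmoothOn (gram e h) e.target

/-- `D'` is a holomorphic connection on `W`: `D' ∂̄ + ∂̄ D' = 0`. The component of
`D' ∂̄ + ∂̄ D'` along `dz_k ∧ dz̄_l` is `-∂̄_l θ_k`. -/
def HermitianMetric.ChernHolomorphicOn {n : ℕ} {M : Type*} [TopologicalSpace M]
    [ChartedSpace (Fin n → ℂ) M] (T : HermitianMetric n M) (W : Set M) : Prop :=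
  ∀ e ∈ atlas (Fin n → ℂ) M, ∀ z ∈ e.target, e.symm z ∈ W →
    ∀ k l, mdzbar l (chern e T.h k) z = 0

/-- A harmonic Higgs bundle `(T_M, h, Φ)`: the connection `D' + ∂̄ + Φ + Φ†` is integrable, which
is spelled out by bidegree. -/
structure HarmonicHiggs (n : ℕ) (M : Type*) [TopologicalSpace M]
    [ChartedSpace (Fin n → ℂ) M] extends HermitianMetric n M where
  /-- the Higgs field `v ↦ Φ_v` -/
  Φ : ∀ x : M, HolTangent n x →ₗ[ℂ] Module.End ℂ (HolTangent n x)
  Φ_smooth : ∀ e ∈ atlas (Fin n → ℂ) M, ∀ k, MSmoothOn (higgsMat e Φ k) e.target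
  /-- `∂̄(Φ) = 0` -/
  dbar_Φ : ∀ e ∈ atlas (Fin n → ℂ) M, ∀ z ∈ e.target, ∀ k l, mdzbar l (higgsMat e Φ k) z = 0
  /-- `Φ ∧ Φ = 0` -/
  Φ_wedge_Φ : ∀ x v w, Φ x v * Φ x w = Φ x w * Φ x v
  /-- `(D')² = 0` -/
  D_sq : ∀ e ∈ atlas (Fin n → ℂ) M, ∀ z ∈ e.target, ∀ k l,
    mdz k (chern e h l) z - mdz l (chern e h k) z
      + (chern e h k z * chern e h l z - chern e h l z * chern e h k z) = 0
  /-- `D'(Φ†) = 0` -/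
  D_Φdag : ∀ e ∈ atlas (Fin n → ℂ) M, ∀ z ∈ e.target, ∀ k l,
    covEnd e h k (higgsAdjMat e h Φ l) z = 0
  /-- `Φ† ∧ Φ† = 0` -/
  Φdag_wedge_Φdag : ∀ x v w, hermAdjoint (h x) (Φ x v) * hermAdjoint (h x) (Φ x w)
    = hermAdjoint (h x) (Φ x w) * hermAdjoint (h x) (Φ x v)
  /-- `D'(Φ) = 0` -/
  D_Φ : ∀ e ∈ atlas (Fin n → ℂ) M, ∀ z ∈ e.target, ∀ k l,
    covEnd e h k (higgsMat e Φ l) z - covEnd e h l (higgsMat e Φ k) z = 0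
  /-- `∂̄(Φ†) = 0` -/
  dbar_Φdag : ∀ e ∈ atlas (Fin n → ℂ) M, ∀ z ∈ e.target, ∀ k l,
    mdzbar k (higgsAdjMat e h Φ l) z - mdzbar l (higgsAdjMat e h Φ k) z = 0
  /-- `D' ∂̄ + ∂̄ D' = -(Φ ∧ Φ† + Φ† ∧ Φ)`, component along `dz_k ∧ dz̄_l` -/
  curvature : ∀ e ∈ atlas (Fin n → ℂ) M, ∀ z ∈ e.target, ∀ k l,
    -mdzbar l (chern e h k) z
      = -(higgsMat e Φ k z * higgsAdjMat e h Φ l z - higgsAdjMat e h Φ l z * higgsMat e Φ k z)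

/-- An integrable harmonic Higgs bundle `(T_M, h, Φ, U, Q)`. -/
structure IntegrableHarmonicHiggs (n : ℕ) (M : Type*) [TopologicalSpace M]
    [ChartedSpace (Fin n → ℂ) M] extends HarmonicHiggs n M where
  U : ∀ x : M, Module.End ℂ (HolTangent n x)
  Q : ∀ x : M, Module.End ℂ (HolTangent n x)
  U_smooth : ∀ e ∈ atlas (Fin n → ℂ) M, MSmoothOn (endMat e U) e.target
  Q_smooth : ∀ e ∈ atlas (Fin n → ℂ) M, MSmoothOn (endMat e Q) e.target
  /-- `∂̄(U) = 0` -/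
  dbar_U : ∀ e ∈ atlas (Fin n → ℂ) M, ∀ z ∈ e.target, ∀ k, mdzbar k (endMat e U) z = 0
  /-- `Q† = Q` -/
  Q_selfAdjoint : ∀ x, hermAdjoint (h x) (Q x) = Q x
  /-- `[Φ, U] = 0` -/
  Φ_comm_U : ∀ x v, Φ x v * U x - U x * Φ x v = 0
  /-- `D'(U) - [Φ, Q] + Φ = 0` -/
  D_U : ∀ e ∈ atlas (Fin n → ℂ) M, ∀ z ∈ e.target, ∀ k,
    covEnd e h k (endMat e U) z
      - (higgsMat e Φ k z * endMat e Q z - endMat e Q z * higgsMat e Φ k z)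
      + higgsMat e Φ k z = 0
  /-- `D'(Q) + [Φ, U†] = 0` -/
  D_Q : ∀ e ∈ atlas (Fin n → ℂ) M, ∀ z ∈ e.target, ∀ k,
    covEnd e h k (endMat e Q) z
      + (higgsMat e Φ k z * endMat e (fun x => hermAdjoint (h x) (U x)) z
        - endMat e (fun x => hermAdjoint (h x) (U x)) z * higgsMat e Φ k z) = 0

/-- A tt*-bundle `(T_M, h, Φ, κ, U, Q)`: an integrable harmonic Higgs bundle with a real structure
`κ` such that `U* = U` and `Q* + Q = 0`, where `*` is the adjoint with respect to the bilinear form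
`g(v, w) = h(v, κ w)`. -/
structure TTStarBundle (n : ℕ) (M : Type*) [TopologicalSpace M]
    [ChartedSpace (Fin n → ℂ) M] extends IntegrableHarmonicHiggs n M where
  /-- the real structure, an antilinear endomorphism of `T_M` -/
  κ : ∀ x : M, HolTangent n x →ₗ⋆[ℂ] HolTangent n x
  κ_smooth : ∀ e ∈ atlas (Fin n → ℂ) M, MSmoothOn (antiMat e κ) e.target
  /-- `κ² = id` -/
  κ_κ : ∀ x v, κ x (κ x v) = v
  h_κ_κ : ∀ x v w, h x (κ x v) (κ x w) = conj (h x v w)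
  /-- `D(κ) = 0`, first half: `D'_{∂_k} (κ s) = κ (∂̄_k s)` for all `s` -/
  D_κ : ∀ e ∈ atlas (Fin n → ℂ) M, ∀ z ∈ e.target, ∀ k,
    mdz k (antiMat e κ) z + chern e h k z * antiMat e κ z = 0
  /-- `D(κ) = 0`, second half: `∂̄_k (κ s) = κ (D'_{∂_k} s)` for all `s` -/
  dbar_κ : ∀ e ∈ atlas (Fin n → ℂ) M, ∀ z ∈ e.target, ∀ k,
    mdzbar k (antiMat e κ) z = antiMat e κ z * (chern e h k z).map conj
  /-- `U* = U` -/
  U_real : ∀ x v w, h x (U x v) (κ x w) = h x v (κ x (U x w))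
  /-- `Q* + Q = 0` -/
  Q_real : ∀ x v w, h x (Q x v) (κ x w) + h x v (κ x (Q x w)) = 0

/-! ### Flat holomorphic frames -/

/-- The vector fields `X 0, …, X (n-1)` form on `W` a frame of `T_M` that is holomorphic and flat
(`D' X j = 0`) for the Chern connection of `h`. -/
structure HermitianMetric.IsFlatHolomorphicFrameOn {n : ℕ} {M : Type*} [TopologicalSpace M]
    [ChartedSpace (Fin n → ℂ) M] (T : HermitianMetric n M) (X : Fin n → ∀ x : M, HolTangent n x)
    (W : Set M) : Prop where
  linearIndependent : ∀ x ∈ W, LinearIndependent ℂ fun j => X j x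
  holomorphic : ∀ e ∈ atlas (Fin n → ℂ) M, ∀ j,
    DifferentiableOn ℂ (fun z => comps e z (X j (e.symm z))) (e.target ∩ e.symm ⁻¹' W)
  flat : ∀ e ∈ atlas (Fin n → ℂ) M, ∀ z ∈ e.target, e.symm z ∈ W → ∀ j k i,
    dz k (fun w => comps e w (X j (e.symm w)) i) z
      + (chern e T.h k z *ᵥ comps e z (X j (e.symm z))) i = 0

/-! ### The structure connection on a fibre and its monodromy -/

/-- The structure connection `D' + Φ/z + (U/z - Q - z U†) dz/z`, restricted to `ℂ* × {x}`, is
`d/dz + A(z)` with `A(z) = U/z² - Q/z - U†` on the fixed vector space `T_x M`. -/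
def IntegrableHarmonicHiggs.fibreConn {n : ℕ} {M : Type*} [TopologicalSpace M]
    [ChartedSpace (Fin n → ℂ) M] (T : IntegrableHarmonicHiggs n M) (x : M) (z : ℂ) :
    Module.End ℂ (HolTangent n x) :=
  (z ^ 2)⁻¹ • T.U x - z⁻¹ • T.Q x - hermAdjoint (T.h x) (T.U x)

theorem continuousSMul_real (V : Type*) [AddCommGroup V] [Module ℂ V] [TopologicalSpace V]
    [ContinuousSMul ℂ V] : ContinuousSMul ℝ V :=
  ⟨by
    have h : Continuous fun q : ℝ × V => (q.1 : ℂ) • q.2 :=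
      (Complex.continuous_ofReal.comp continuous_fst).smul continuous_snd
    simpa only [Complex.coe_smul] using h⟩

/-- `y` is a parallel section, for `d/dz + A(z)`, along the path `γ : [0,1] → ℂ`. -/
def IsParallelAlong {V : Type*} [AddCommGroup V] [Module ℂ V] [TopologicalSpace V]
    [ContinuousSMul ℂ V] (A : ℂ → Module.End ℂ V) (γ : ℝ → ℂ) (y : ℝ → V) : Prop :=
  have : ContinuousSMul ℝ V := continuousSMul_real V
  ∀ t ∈ Set.Icc (0 : ℝ) 1, HasDerivWithinAt y
    (-(derivWithin γ (Set.Icc 0 1) t • A (γ t) (y t))) (Set.Icc 0 1) t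

/-- `P` is the parallel transport of `d/dz + A(z)` along the path `γ : [0,1] → ℂ`. -/
def IsParallelTransport {V : Type*} [AddCommGroup V] [Module ℂ V] [TopologicalSpace V]
    [ContinuousSMul ℂ V] (A : ℂ → Module.End ℂ V) (γ : ℝ → ℂ) (P : Module.End ℂ V) : Prop :=
  (∀ v, ∃ y, IsParallelAlong A γ y ∧ y 0 = v) ∧
    ∀ y, IsParallelAlong A γ y → y 1 = P (y 0)

/-- The monodromy representation of the local system of flat sections of `d/dz + A(z)` on `ℂ*` is
trivial: parallel transport along every (`C¹`) loop in `ℂ*` is the identity. -/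
def TrivialMonodromy {V : Type*} [AddCommGroup V] [Module ℂ V] [TopologicalSpace V]
    [ContinuousSMul ℂ V] (A : ℂ → Module.End ℂ V) : Prop :=
  ∀ γ : ℝ → ℂ, ContDiffOn ℝ 1 γ (Set.Icc 0 1) → (∀ t ∈ Set.Icc (0 : ℝ) 1, γ t ≠ 0) →
    γ 0 = γ 1 → IsParallelTransport A γ 1

end TTStar

end

namespace TTStar

/-! ### Matrix algebra -/

/-! Everything rests on the spectrum of `Q`. Since `Q` is self-adjoint for `h` and anticommutes with
`κ`, its trace is both real and imaginary, hence zero; in odd dimension the same holds for the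
determinant. In dimension three, Cayley–Hamilton then gives `Q³ = (tr Q² / 2) Q`, so the spectrum at
each point has the form `{-a, 0, a}` (`endMat_Q_pow_three`).

When `D'(U) = 0`, the equation for `D'(U)` becomes `[Φ, Q] = Φ`: each `Φ_k` sends the `λ`-eigenspace
of `Q` to the `(λ - 1)`-eigenspace. A nonzero `Φ` needs two eigenvalues at distance one, which
forces `a` to be `±1` or `±1/2`. Avoiding given eigenvalues is an open condition, so in the first
claim `Φ` vanishes near `p` (`eq_zero_of_shift_of_pow_three`), and the curvature equation makes `D'`
holomorphic there.

If `D'` is holomorphic, the curvature equation instead gives `[Φ_k, Φ_k†] = 0`. Then `tr(Φ_k Φ_k†) =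
tr([Φ_k, Q] Φ_k†) = 0`, so `Φ = 0` (`eq_zero_of_shift_of_normal`). Now `Q` is `D'`-parallel and,
being self-adjoint, holomorphic; `tr Q²` is locally constant and so are the eigenvalues `-a, 0, a`.
Their spectral projectors are quadratic polynomials in `Q`, hence parallel and holomorphic of rank
one. On the image of such a projector `D'` is given by a closed holomorphic `1`-form, whose
primitive provides the factor that makes a section flat (`exists_smul_flat`,
`exists_flat_eigenframe`).

For the monodromy, `U(p) = 0` leaves the connection `d/dz - Q/z`. On eigenvectors its solutions are
powers `z^m` with `m` in `{-1, 0, 1}`, which are single-valued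
(`trivialMonodromy_of_integral_eigenbasis`). -/

theorem pow_three_eq_of_trace_eq_zero_of_det_eq_zero (A : Matrix (Fin 3) (Fin 3) ℂ)
    (ht : A.trace = 0) (hd : A.det = 0) : A ^ 3 = ((A * A).trace / 2) • A := by
  have h2 : A 2 2 = - A 0 0 - A 1 1 := by
    simp [Matrix.trace_fin_three] at ht
    linear_combination ht
  rw [Matrix.det_fin_three] at hd
  rw [h2] at hd
  ext i j
  fin_cases i <;> fin_cases j <;>
    -- Cayley–Hamilton with `e₁ = e₃ = 0` and `e₂ = -tr A² / 2`. Once the trace has eliminated `A 2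
    -- 2`, only diagonal entries still need `det A = 0`.
    simp [pow_succ, Matrix.mul_apply, Fin.sum_univ_three, Matrix.trace_fin_three, h2] <;> first
    | (ring1)
    | linear_combination hd

/-- A self-adjoint matrix that anticommutes with a real structure is traceless. -/
theorem trace_eq_zero_of_anticommute_real_structure {n : ℕ} {A H K : Matrix (Fin n) (Fin n) ℂ}
    (hH : IsUnit H.det) (hA : H * A = Aᴴ * H) (hK : K * K.map conj = 1)
    (hAK : A * K = -(K * A.map conj)) : A.trace = 0 := by
  have hA' : A = H⁻¹ * (Aᴴ * H) := by
    rw [← hA, Matrix.nonsing_inv_mul_cancel_left _ _ hH]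
  have hA'' : A = -(K * A.map conj * K.map conj) := by
    rw [← neg_mul, ← hAK, mul_assoc, hK, mul_one]
  have hK' : K.map conj * K = 1 := mul_eq_one_comm.mp hK
  have hconj : A.map conj = (Aᴴ)ᵀ := by ext i j; simp
  -- Conjugation by `H` shows the trace is real; conjugation by the real structure, in `t2`, shows
  -- it is imaginary.
  have t1 : A.trace = Aᴴ.trace := by
    conv_lhs => rw [hA', Matrix.trace_mul_comm, mul_assoc, Matrix.mul_nonsing_inv _ hH, mul_one]
  have t2 : A.trace = -Aᴴ.trace := by
    conv_lhs => rw [hA'', Matrix.trace_neg, Matrix.trace_mul_comm, ← mul_assoc, hK', one_mul, hconj,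
      Matrix.trace_transpose]
  linear_combination (t1 + t2) / 2

/-- In odd dimension, a self-adjoint matrix that anticommutes with a real structure is singular. -/
theorem det_eq_zero_of_anticommute_real_structure {n : ℕ} (hn : Odd n)
    {A H K : Matrix (Fin n) (Fin n) ℂ}
    (hH : IsUnit H.det) (hA : H * A = Aᴴ * H) (hK : K * K.map conj = 1)
    (hAK : A * K = -(K * A.map conj)) : A.det = 0 := by
  have hA'' : A = -(K * A.map conj * K.map conj) := by
    rw [← neg_mul, ← hAK, mul_assoc, hK, mul_one]
  have hconj : A.map conj = (Aᴴ)ᵀ := by ext i j; simp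
  have d1 : A.det = Aᴴ.det := by
    have h := congrArg Matrix.det hA
    rw [Matrix.det_mul, Matrix.det_mul, mul_comm] at h
    exact hH.mul_right_cancel h
  have d2 : A.det = -Aᴴ.det := by
    have h := congrArg Matrix.det hK
    rw [Matrix.det_mul, Matrix.det_one] at h
    conv_lhs => rw [hA'', Matrix.det_neg, Matrix.det_mul, Matrix.det_mul, hconj,
      Matrix.det_transpose]
    -- Odd size is what keeps the sign; the factors `det K` and its conjugate cancel because of
    -- `hK`.
    rw [Fintype.card_fin, hn.neg_one_pow]
    linear_combination (-Aᴴ.det) * h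
  linear_combination (d1 + d2) / 2

/-- Rewriting `hN` as `N A = (A + 1) N` gives `N A³ = (A + 1)³ N`. Substituting the cubic relation
and eliminating `c` leaves `(A + 1/2)(A + 1) A N = 0`. Excluding `-1/2` and `-1` gives `A N = 0`, so
`N A = N`, and excluding `1` finishes. -/
theorem eq_zero_of_shift_of_pow_three {A N : Matrix (Fin 3) (Fin 3) ℂ} {c : ℂ}
    (hA : A ^ 3 = c • A) (hN : N * A - A * N = N)
    (h1 : ((1 : ℂ) • (1 : Matrix (Fin 3) (Fin 3) ℂ) - A).det ≠ 0)
    (h2 : ((-1 : ℂ) • (1 : Matrix (Fin 3) (Fin 3) ℂ) - A).det ≠ 0)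
    (h3 : ((-1 / 2 : ℂ) • (1 : Matrix (Fin 3) (Fin 3) ℂ) - A).det ≠ 0) : N = 0 := by
  have hunit {μ : ℂ} {B : Matrix (Fin 3) (Fin 3) ℂ}
      (h : (μ • (1 : Matrix (Fin 3) (Fin 3) ℂ) - A).det ≠ 0)
      (hB : B = -(μ • (1 : Matrix (Fin 3) (Fin 3) ℂ) - A)) : IsUnit B :=
    hB ▸ ((Matrix.isUnit_iff_isUnit_det _).mpr (isUnit_iff_ne_zero.mpr h)).neg
  have hNA : N * A = (A + 1) * N := by rw [add_mul, one_mul, ← sub_eq_iff_eq_add']; exact hN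
  have hNA3 : N * A ^ 3 = (A + 1) ^ 3 * N := by
    have hNAA : N * A * A = (A + 1) * (N * A) := by rw [← mul_assoc, ← hNA]
    calc N * A ^ 3 = N * A * A * A := by noncomm_ring
      _ = (A + 1) * (N * A * A) := by rw [hNAA, mul_assoc, hNAA]
      _ = (A + 1) * ((A + 1) * ((A + 1) * N)) := by rw [hNAA, hNA]
      _ = _ := by noncomm_ring
  have key : c • ((A + 1) * N) = (A + 1) ^ 3 * N := by
    rw [← hNA3, hA, Matrix.mul_smul, hNA]
  have e1 : (A + 1) ^ 3 = A ^ 3 + (3 : ℂ) • A ^ 2 + (3 : ℂ) • A + 1 := by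
    simp only [pow_succ, pow_zero, one_mul, add_mul, mul_add, mul_one]
    module
  have key2 : ((3 : ℂ) • A ^ 2 + (3 : ℂ) • A + 1) * N = c • N := by
    have : c • ((A + 1) * N) = (c • A) * N + c • N := by
      rw [add_mul, one_mul, smul_add, Matrix.smul_mul]
    rw [this, e1, ← hA, add_assoc, add_assoc, add_mul, add_right_inj] at key
    rw [key, add_assoc]
  -- Multiplying `key2` by `A` makes `c` disappear through `c A = A³`, and `2A³ + 3A² + A` factors
  -- as `2 (A + 1/2)(A + 1) A`.
  have key3 : (A + (1 / 2 : ℂ) • (1 : Matrix (Fin 3) (Fin 3) ℂ)) * ((A + 1) * (A * N)) = 0 := by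
    have h := congrArg (A * ·) key2
    simp only [Matrix.mul_smul] at h
    have h' : c • (A * N) = A ^ 3 * N := by rw [hA, Matrix.smul_mul]
    rw [h'] at h
    have h2' : (2 : ℂ) • ((A + (1 / 2 : ℂ) • (1 : Matrix (Fin 3) (Fin 3) ℂ)) *
        ((A + 1) * (A * N))) = A * (((3 : ℂ) • A ^ 2 + (3 : ℂ) • A + 1) * N) - A ^ 3 * N := by
      simp only [pow_succ, pow_zero, one_mul, add_mul, mul_add, smul_mul_assoc,
        mul_smul_comm, mul_assoc]
      module
    rw [h, sub_self] at h2'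
    exact (smul_eq_zero.mp h2').resolve_left two_ne_zero
  have hAN : A * N = 0 := by
    have k1 : IsUnit (A + (1 / 2 : ℂ) • (1 : Matrix (Fin 3) (Fin 3) ℂ)) := hunit h3 (by module)
    have k2 : IsUnit (A + 1) := hunit h2 (by module)
    exact k2.mul_right_eq_zero.mp (k1.mul_right_eq_zero.mp key3)
  have : N * (A - 1) = 0 := by rw [mul_sub, hNA, add_mul, hAN]; simp
  exact (hunit h1 (by module) : IsUnit (A - 1)).mul_left_eq_zero.mp this

open scoped ComplexOrder MatrixOrder in
/-- A matrix that commutes with its adjoint and shifts another one vanishes. -/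
theorem eq_zero_of_shift_of_normal {n : ℕ} {A N B H : Matrix (Fin n) (Fin n) ℂ}
    (hH : H.PosDef) (hB : H * N = Bᴴ * H) (hN : N * A - A * N = N) (hNB : N * B = B * N) :
    N = 0 := by
  -- Cyclicity of the trace and `N B = B N` give `tr(N A B) = tr(A N B)`. As `B` is the `H`-adjoint
  -- of `N`, this trace is a squared norm of `N`.
  have ht : (N * B).trace = 0 := by
    have h1 : (N * A * B).trace = (A * N * B).trace := by
      rw [mul_assoc, Matrix.trace_mul_comm, mul_assoc, ← hNB, mul_assoc]
    conv_lhs => rw [← hN, sub_mul, Matrix.trace_sub, h1, sub_self]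
  -- Writing `H = R* R` passes to an orthonormal frame: `R B R⁻¹` is the conjugate transpose of `R N
  -- R⁻¹`, and the trace becomes a Frobenius norm.
  obtain ⟨R, hR⟩ := CStarAlgebra.nonneg_iff_eq_star_mul_self.mp hH.posSemidef.nonneg
  rw [Matrix.star_eq_conjTranspose] at hR
  have hRu : IsUnit R.det := by
    have := hH.det_pos.ne'
    rw [hR, Matrix.det_mul] at this
    exact isUnit_iff_ne_zero.mpr (right_ne_zero_of_mul this)
  have hRu' : IsUnit Rᴴ.det := by rw [Matrix.det_conjTranspose]; exact hRu.star
  have hB' : H * B = Nᴴ * H := by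
    have := congrArg Matrix.conjTranspose hB
    simpa [Matrix.conjTranspose_mul, hH.isHermitian.eq] using this.symm
  have hRB : R * B * R⁻¹ = (R * N * R⁻¹)ᴴ := by
    have h1 : Rᴴ * (R * B * R⁻¹) = Nᴴ * Rᴴ := by
      rw [← mul_assoc, ← mul_assoc, ← hR, hB', hR, ← mul_assoc,
        Matrix.mul_nonsing_inv_cancel_right _ _ hRu]
    have h2 := congrArg ((Rᴴ)⁻¹ * ·) h1
    simp only [Matrix.nonsing_inv_mul_cancel_left _ _ hRu'] at h2
    rw [h2, Matrix.conjTranspose_mul, Matrix.conjTranspose_mul, Matrix.conjTranspose_nonsing_inv]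
  have hM : R * N * R⁻¹ = 0 := by
    rw [← Matrix.trace_mul_conjTranspose_self_eq_zero_iff, ← hRB,
      show R * N * R⁻¹ * (R * B * R⁻¹) = R * (N * (R⁻¹ * (R * B))) * R⁻¹ by noncomm_ring,
      Matrix.nonsing_inv_mul_cancel_left _ _ hRu, Matrix.trace_mul_comm,
      Matrix.nonsing_inv_mul_cancel_left _ _ hRu, ht]
  have := congrArg (R⁻¹ * · * R) hM
  simpa [mul_assoc, Matrix.nonsing_inv_mul _ hRu, Matrix.nonsing_inv_mul_cancel_left _ _ hRu]
    using this

/-! ### Hermitian adjoints -/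

theorem hermAdjoint_spec {V : Type*} [AddCommGroup V] [Module ℂ V] [FiniteDimensional ℂ V]
    {h : V →ₗ[ℂ] V →ₗ⋆[ℂ] ℂ} (hs : ∀ v w, h v w = conj (h w v))
    (hp : ∀ v, v ≠ 0 → 0 < (h v v).re) (A : Module.End ℂ V) (v w : V) :
    h (A v) w = h v (hermAdjoint h A w) := by
  have H := exists_hermAdjoint h hs hp A
  rw [hermAdjoint, dif_pos H]
  exact H.choose_spec v w

theorem hermAdjoint_zero {V : Type*} [AddCommGroup V] [Module ℂ V] [FiniteDimensional ℂ V]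
    {h : V →ₗ[ℂ] V →ₗ⋆[ℂ] ℂ} (hs : ∀ v w, h v w = conj (h w v))
    (hp : ∀ v, v ≠ 0 → 0 < (h v v).re) : hermAdjoint h (0 : Module.End ℂ V) = 0 := by
  ext w
  by_contra hw
  have h0 := hermAdjoint_spec hs hp 0 (hermAdjoint h 0 w) w
  have h1 := hp _ hw
  rw [← h0] at h1
  simp at h1

/-- The Gram matrix of a sesquilinear form in a basis. -/
noncomputable def gramOf {n : ℕ} {V : Type*} [AddCommGroup V] [Module ℂ V] (h : V →ₗ[ℂ] V →ₗ⋆[ℂ] ℂ)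
    (b : Module.Basis (Fin n) ℂ V) : Matrix (Fin n) (Fin n) ℂ :=
  Matrix.of fun i j => h (b j) (b i)

section Gram

variable {n : ℕ} {V : Type*} [AddCommGroup V] [Module ℂ V] {h : V →ₗ[ℂ] V →ₗ⋆[ℂ] ℂ}
  (b : Module.Basis (Fin n) ℂ V)

theorem gramOf_mul_toMatrix (A : Module.End ℂ V) (i j : Fin n) :
    (gramOf h b * LinearMap.toMatrix b b A) i j = h (A (b j)) (b i) := by
  conv_rhs => rw [← b.sum_repr (A (b j))]
  simp [-Module.Basis.sum_repr, Matrix.mul_apply, gramOf, LinearMap.toMatrix_apply, mul_comm]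

theorem conjTranspose_toMatrix_mul_gramOf (A : Module.End ℂ V) (i j : Fin n) :
    ((LinearMap.toMatrix b b A)ᴴ * gramOf h b) i j = h (b j) (A (b i)) := by
  conv_rhs => rw [← b.sum_repr (A (b i))]
  simp [-Module.Basis.sum_repr, Matrix.mul_apply, gramOf, LinearMap.toMatrix_apply]

theorem gramOf_mul_eq_of_adjoint {A B : Module.End ℂ V} (hAB : ∀ v w, h (A v) w = h v (B w)) :
    gramOf h b * LinearMap.toMatrix b b A = (LinearMap.toMatrix b b B)ᴴ * gramOf h b := by
  ext i j
  rw [gramOf_mul_toMatrix, conjTranspose_toMatrix_mul_gramOf, hAB]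

theorem gramOf_isHermitian (hs : ∀ v w, h v w = conj (h w v)) : (gramOf h b).IsHermitian := by
  ext i j
  simp [gramOf, ← hs]

open scoped ComplexOrder in
theorem gramOf_posDef (hs : ∀ v w, h v w = conj (h w v)) (hp : ∀ v, v ≠ 0 → 0 < (h v v).re) :
    (gramOf h b).PosDef := by
  refine Matrix.PosDef.of_dotProduct_mulVec_pos (gramOf_isHermitian b hs) fun x hx => ?_
  have hx' : ∑ i, x i • b i ≠ 0 := fun h0 => hx <| by
    ext i
    exact Fintype.linearIndependent_iff.mp b.linearIndependent x h0 i
  have h1 := hp _ hx'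
  have h2 : star x ⬝ᵥ (gramOf h b *ᵥ x) = h (∑ i, x i • b i) (∑ i, x i • b i) := by
    simp [dotProduct, Matrix.mulVec, gramOf, Finset.mul_sum, mul_comm, mul_left_comm]
  have h3 : (h (∑ i, x i • b i) (∑ i, x i • b i)).im = 0 := by
    have := congrArg Complex.im (hs (∑ i, x i • b i) (∑ i, x i • b i))
    rw [Complex.conj_im] at this
    linarith
  rw [h2, Complex.pos_iff]
  exact ⟨h1, h3.symm⟩

end Gram

/-! ### Coordinate frames -/

section Frame

variable {n : ℕ} {M : Type*} [TopologicalSpace M] [ChartedSpace (Fin n → ℂ) M]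
  [IsManifold 𝓘(ℂ, Fin n → ℂ) ω M] {e : OpenPartialHomeomorph M (Fin n → ℂ)}
  (he : e ∈ atlas (Fin n → ℂ) M) {z : Fin n → ℂ} (hz : z ∈ e.target)

theorem mdifferentiable_of_mem_atlas' {e : OpenPartialHomeomorph M (Fin n → ℂ)}
    (he : e ∈ atlas (Fin n → ℂ) M) :
    e.MDifferentiable 𝓘(ℂ, Fin n → ℂ) 𝓘(ℂ, Fin n → ℂ) :=
  haveI : IsManifold 𝓘(ℂ, Fin n → ℂ) 1 M := IsManifold.of_le (n := ω) le_top
  mdifferentiable_of_mem_atlas he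

/-- The components in the coordinate frame, as a linear equivalence. -/
noncomputable def compsEquiv : HolTangent n (e.symm z) ≃ₗ[ℂ] (Fin n → ℂ) :=
  LinearEquiv.ofBijective
    (mfderiv 𝓘(ℂ, Fin n → ℂ) 𝓘(ℂ, Fin n → ℂ) e (e.symm z)).toLinearMap
    ((mdifferentiable_of_mem_atlas' he).mfderiv_bijective (e.map_target hz))

theorem compsEquiv_apply (v : HolTangent n (e.symm z)) : compsEquiv he hz v = comps e z v := rfl

/-- The coordinate frame as a basis. -/
noncomputable def coordBasis : Module.Basis (Fin n) ℂ (HolTangent n (e.symm z)) :=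
  Module.Basis.ofEquivFun (compsEquiv he hz)

theorem coordBasis_repr (v : HolTangent n (e.symm z)) (i : Fin n) :
    (coordBasis he hz).repr v i = comps e z v i := rfl

include he hz in
theorem comps_coordVec (k : Fin n) : comps e z (coordVec e z k) = Pi.single k 1 :=
  congrArg (fun f => f (Pi.single k (1 : ℂ) : Fin n → ℂ))
    ((mdifferentiable_of_mem_atlas' he).comp_symm_deriv hz)

theorem coordBasis_apply (k : Fin n) : coordBasis he hz k = coordVec e z k := by
  apply (compsEquiv he hz).injective
  rw [compsEquiv_apply, compsEquiv_apply, comps_coordVec he hz, ← compsEquiv_apply he hz]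
  simp [coordBasis]

theorem endMat_eq (A : ∀ x : M, Module.End ℂ (HolTangent n x)) :
    endMat e A z = LinearMap.toMatrix (coordBasis he hz) (coordBasis he hz) (A (e.symm z)) := by
  ext i j
  rw [LinearMap.toMatrix_apply, coordBasis_apply, coordBasis_repr]; rfl

theorem higgsMat_eq (Φ : ∀ x : M, HolTangent n x →ₗ[ℂ] Module.End ℂ (HolTangent n x))
    (k : Fin n) : higgsMat e Φ k z = LinearMap.toMatrix (coordBasis he hz) (coordBasis he hz)
      (Φ (e.symm z) (coordVec e z k)) := by
  ext i j
  rw [LinearMap.toMatrix_apply, coordBasis_apply, coordBasis_repr]; rfl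

theorem higgsAdjMat_eq (h : ∀ x : M, HolTangent n x →ₗ[ℂ] HolTangent n x →ₗ⋆[ℂ] ℂ)
    (Φ : ∀ x : M, HolTangent n x →ₗ[ℂ] Module.End ℂ (HolTangent n x))
    (k : Fin n) : higgsAdjMat e h Φ k z = LinearMap.toMatrix (coordBasis he hz) (coordBasis he hz)
      (hermAdjoint (h (e.symm z)) (Φ (e.symm z) (coordVec e z k))) := by
  ext i j
  rw [LinearMap.toMatrix_apply, coordBasis_apply, coordBasis_repr]; rfl

theorem gram_eq (h : ∀ x : M, HolTangent n x →ₗ[ℂ] HolTangent n x →ₗ⋆[ℂ] ℂ) :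
    gram e h z = gramOf (h (e.symm z)) (coordBasis he hz) := by
  ext i j
  simp [gram, gramOf, coordBasis_apply]

include he hz in
theorem coordVec_sum_comps (v : HolTangent n (e.symm z)) :
    ∑ i, comps e z v i • coordVec e z i = v := by
  rw [← (coordBasis he hz).sum_repr v]
  simp [← coordBasis_apply he hz, ← coordBasis_repr he hz]

include he hz in
theorem comps_end_apply (A : ∀ x : M, Module.End ℂ (HolTangent n x))
    (v : HolTangent n (e.symm z)) :
    comps e z (A (e.symm z) v) = endMat e A z *ᵥ comps e z v := by
  rw [endMat_eq he hz]
  ext i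
  have := LinearMap.toMatrix_mulVec_repr (coordBasis he hz) (coordBasis he hz) (A (e.symm z)) v
  exact (congrFun this i).symm

include he hz in
theorem comps_antilinear_apply (κ : ∀ x : M, HolTangent n x →ₗ⋆[ℂ] HolTangent n x)
    (v : HolTangent n (e.symm z)) (i : Fin n) :
    comps e z (κ (e.symm z) v) i = ∑ k, antiMat e κ z i k * conj (comps e z v k) := by
  conv_lhs => rw [← (coordBasis he hz).sum_repr v]
  rw [← coordBasis_repr he hz]
  simp [-Module.Basis.sum_repr, antiMat, ← coordBasis_repr he hz, coordBasis_apply, mul_comm]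

end Frame

/-! ### Wirtinger calculus -/

section Wirtinger

variable {n : ℕ} {f g : (Fin n → ℂ) → ℂ} {z : Fin n → ℂ} {k : Fin n}

theorem dz_congr (h : f =ᶠ[nhds z] g) : dz k f z = dz k g z := by
  rw [dz, dz, h.fderiv_eq]

theorem dz_const (c : ℂ) : dz k (fun _ => c) z = 0 := by simp [dz]

theorem dz_add (hf : DifferentiableAt ℝ f z) (hg : DifferentiableAt ℝ g z) :
    dz k (fun w => f w + g w) z = dz k f z + dz k g z := by
  simp only [dz, fderiv_fun_add hf hg, add_apply]
  ring

theorem dz_mul (hf : DifferentiableAt ℝ f z) (hg : DifferentiableAt ℝ g z) :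
    dz k (fun w => f w * g w) z = dz k f z * g z + f z * dz k g z := by
  simp only [dz, fderiv_fun_mul hf hg, add_apply, smul_apply, smul_eq_mul]
  ring

theorem dz_sum {ι : Type*} (s : Finset ι) {F : ι → (Fin n → ℂ) → ℂ}
    (hF : ∀ i ∈ s, DifferentiableAt ℝ (F i) z) :
    dz k (fun w => ∑ i ∈ s, F i w) z = ∑ i ∈ s, dz k (F i) z := by
  simp only [dz, fderiv_fun_sum hF, sum_apply, Finset.mul_sum, ← Finset.sum_sub_distrib]

theorem dzbar_mul (hf : DifferentiableAt ℝ f z) (hg : DifferentiableAt ℝ g z) :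
    dzbar k (fun w => f w * g w) z = dzbar k f z * g z + f z * dzbar k g z := by
  simp only [dzbar, fderiv_fun_mul hf hg, add_apply, smul_apply, smul_eq_mul]
  ring

theorem dzbar_sum {ι : Type*} (s : Finset ι) {F : ι → (Fin n → ℂ) → ℂ}
    (hF : ∀ i ∈ s, DifferentiableAt ℝ (F i) z) :
    dzbar k (fun w => ∑ i ∈ s, F i w) z = ∑ i ∈ s, dzbar k (F i) z := by
  simp only [dzbar, fderiv_fun_sum hF, sum_apply, Finset.mul_sum, ← Finset.sum_add_distrib]

theorem fderiv_conj (hf : DifferentiableAt ℝ f z) (v : Fin n → ℂ) :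
    fderiv ℝ (fun w => conj (f w)) z v = conj (fderiv ℝ f z v) := by
  have h := (Complex.conjCLE.toContinuousLinearMap.hasFDerivAt (x := f z)).comp z hf.hasFDerivAt
  rw [show (fun w => conj (f w)) = (Complex.conjCLE.toContinuousLinearMap : ℂ → ℂ) ∘ f from rfl,
    h.fderiv]
  rfl

theorem DifferentiableAt.conj_real (hf : DifferentiableAt ℝ f z) :
    DifferentiableAt ℝ (fun w => conj (f w)) z :=
  (Complex.conjCLE.toContinuousLinearMap.differentiableAt).comp z hf

theorem dz_conj (hf : DifferentiableAt ℝ f z) :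
    dz k (fun w => conj (f w)) z = conj (dzbar k f z) := by
  simp [dz, dzbar, fderiv_conj hf, map_ofNat]
  ring

theorem dzbar_conj (hf : DifferentiableAt ℝ f z) :
    dzbar k (fun w => conj (f w)) z = conj (dz k f z) := by
  simp [dz, dzbar, fderiv_conj hf, map_ofNat]

theorem pi_eq_sum_re_im (v : Fin n → ℂ) :
    v = ∑ k, ((v k).re • (Pi.single k 1 : Fin n → ℂ)
      + (v k).im • (Pi.single k Complex.I : Fin n → ℂ)) := by
  ext i
  simp [Finset.sum_apply, Pi.single_apply, Finset.sum_add_distrib]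

theorem fderiv_real_apply (v : Fin n → ℂ) :
    fderiv ℝ f z v = ∑ k, (v k * dz k f z + conj (v k) * dzbar k f z) := by
  conv_lhs => rw [pi_eq_sum_re_im v]
  rw [map_sum]
  refine Finset.sum_congr rfl fun k _ => ?_
  rw [map_add, map_smul, map_smul, Complex.real_smul, Complex.real_smul, dz, dzbar]
  conv_rhs => rw [← Complex.re_add_im (v k)]
  simp only [map_add, map_mul, Complex.conj_ofReal, Complex.conj_I]
  ring_nf
  simp only [Complex.I_sq]
  ring

/-- Cauchy–Riemann: without its `dz̄` part, the real differential is a complex combination of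
coordinate projections, hence complex linear. -/
theorem differentiableAt_complex_of_dzbar_eq_zero (hf : DifferentiableAt ℝ f z)
    (h : ∀ k, dzbar k f z = 0) : DifferentiableAt ℂ f z := by
  let L : (Fin n → ℂ) →L[ℂ] ℂ := ∑ k, dz k f z • ContinuousLinearMap.proj k
  have hL : L.restrictScalars ℝ = fderiv ℝ f z := by
    ext v
    rw [fderiv_real_apply]
    simp [L, h, mul_comm]
  exact (hasFDerivAt_of_restrictScalars ℝ hf.hasFDerivAt hL).differentiableAt

theorem differentiableAt_conj_complex_of_dz_eq_zero (hf : DifferentiableAt ℝ f z)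
    (h : ∀ k, dz k f z = 0) : DifferentiableAt ℂ (fun w => conj (f w)) z :=
  differentiableAt_complex_of_dzbar_eq_zero (DifferentiableAt.conj_real hf) fun k => by
    rw [dzbar_conj hf, h, map_zero]

theorem dz_eq_fderiv (hf : DifferentiableAt ℂ f z) :
    dz k f z = fderiv ℂ f z (Pi.single k 1) := by
  have h1 : (Pi.single k Complex.I : Fin n → ℂ) = Complex.I • Pi.single k (1 : ℂ) := by
    rw [← Pi.single_smul]; simp
  simp only [dz, hf.fderiv_restrictScalars ℝ, ContinuousLinearMap.coe_restrictScalars', h1,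
    map_smul, smul_eq_mul]
  linear_combination (-(1 / 2) * fderiv ℂ f z (Pi.single k 1)) * Complex.I_sq

theorem dzbar_eq_zero (hf : DifferentiableAt ℂ f z) : dzbar k f z = 0 := by
  have h1 : (Pi.single k Complex.I : Fin n → ℂ) = Complex.I • Pi.single k (1 : ℂ) := by
    rw [← Pi.single_smul]; simp
  simp only [dzbar, hf.fderiv_restrictScalars ℝ, ContinuousLinearMap.coe_restrictScalars', h1,
    map_smul, smul_eq_mul]
  linear_combination ((1 / 2) * fderiv ℂ f z (Pi.single k 1)) * Complex.I_sq

theorem dz_conj_eq_zero (hf : DifferentiableAt ℂ f z) : dz k (fun w => conj (f w)) z = 0 := by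
  rw [dz_conj (hf.restrictScalars ℝ), dzbar_eq_zero hf, map_zero]

theorem fderiv_complex_apply (hf : DifferentiableAt ℂ f z) (v : Fin n → ℂ) :
    fderiv ℂ f z v = ∑ k, v k * dz k f z := by
  have h := fderiv_real_apply (f := f) (z := z) v
  simp only [dzbar_eq_zero hf, mul_zero, add_zero] at h
  rw [← h, hf.fderiv_restrictScalars ℝ]
  rfl

theorem dz_contDiffOn {s : Set (Fin n → ℂ)} (hs : IsOpen s) (hf : ContDiffOn ℝ ∞ f s)
    (k : Fin n) : ContDiffOn ℝ ∞ (dz k f) s := by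
  have h : ContDiffOn ℝ ∞ (fderiv ℝ f) s := hf.fderiv_of_isOpen hs (by norm_num)
  exact contDiffOn_const.mul ((h.clm_apply contDiffOn_const).sub
    (contDiffOn_const.mul (h.clm_apply contDiffOn_const)))

theorem fderiv_dz (hf : ContDiffAt ℝ 2 f z) (v : Fin n → ℂ) :
    fderiv ℝ (dz k f) z v = (1 / 2) * (fderiv ℝ (fderiv ℝ f) z v (Pi.single k 1)
      - Complex.I * fderiv ℝ (fderiv ℝ f) z v (Pi.single k Complex.I)) := by
  have hd : HasFDerivAt (fderiv ℝ f) (fderiv ℝ (fderiv ℝ f) z) z :=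
    ((hf.fderiv_right (m := 1) (by norm_num)).differentiableAt one_ne_zero).hasFDerivAt
  have ha (u : Fin n → ℂ) := hd.clm_apply (hasFDerivAt_const u z)
  have h := ((ha (Pi.single k 1)).sub ((ha (Pi.single k Complex.I)).const_mul Complex.I)).const_mul
    (1 / 2 : ℂ)
  rw [show dz k f = fun w => (1 / 2 : ℂ) * (fderiv ℝ f w (Pi.single k 1)
    - Complex.I * fderiv ℝ f w (Pi.single k Complex.I)) from rfl]
  erw [h.fderiv]
  simp

theorem dz_comm (hf : ContDiffAt ℝ 2 f z) (k l : Fin n) :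
    dz k (dz l f) z = dz l (dz k f) z := by
  have hs : IsSymmSndFDerivAt ℝ f z := hf.isSymmSndFDerivAt (by simp)
  rw [dz, dz]
  simp only [fderiv_dz hf]
  rw [hs (Pi.single k 1) (Pi.single l 1), hs (Pi.single k 1) (Pi.single l Complex.I),
    hs (Pi.single k Complex.I) (Pi.single l 1), hs (Pi.single k Complex.I) (Pi.single l Complex.I)]
  ring

end Wirtinger

/-! ### Matrix-valued functions -/

section MatrixCalculus

variable {n : ℕ} {A B : (Fin n → ℂ) → Matrix (Fin n) (Fin n) ℂ} {z : Fin n → ℂ} {k : Fin n}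
  {s : Set (Fin n → ℂ)}

theorem mdz_mul (hA : ∀ i j, DifferentiableAt ℝ (fun w => A w i j) z)
    (hB : ∀ i j, DifferentiableAt ℝ (fun w => B w i j) z) :
    mdz k (fun w => A w * B w) z = mdz k A z * B z + A z * mdz k B z := by
  ext i j
  simp only [mdz, Matrix.of_apply, Matrix.mul_apply, Matrix.add_apply]
  rw [dz_sum _ fun l _ => (hA i l).fun_mul (hB l j), ← Finset.sum_add_distrib]
  exact Finset.sum_congr rfl fun l _ => dz_mul (hA i l) (hB l j)

theorem mdzbar_mul (hA : ∀ i j, DifferentiableAt ℝ (fun w => A w i j) z)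
    (hB : ∀ i j, DifferentiableAt ℝ (fun w => B w i j) z) :
    mdzbar k (fun w => A w * B w) z = mdzbar k A z * B z + A z * mdzbar k B z := by
  ext i j
  simp only [mdzbar, Matrix.of_apply, Matrix.mul_apply, Matrix.add_apply]
  rw [dzbar_sum _ fun l _ => (hA i l).fun_mul (hB l j), ← Finset.sum_add_distrib]
  exact Finset.sum_congr rfl fun l _ => dzbar_mul (hA i l) (hB l j)

theorem mdzbar_conjTranspose (hA : ∀ i j, DifferentiableAt ℝ (fun w => A w i j) z) :
    mdzbar k (fun w => (A w)ᴴ) z = (mdz k A z)ᴴ := by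
  ext i j
  simp only [mdz, mdzbar, Matrix.of_apply, Matrix.conjTranspose_apply, RCLike.star_def]
  exact dzbar_conj (hA j i)

theorem mdzbar_congr (h : A =ᶠ[nhds z] B) : mdzbar k A z = mdzbar k B z := by
  ext i j
  simp only [mdzbar, Matrix.of_apply, dzbar]
  have : (fun w => A w i j) =ᶠ[nhds z] fun w => B w i j := h.mono fun w hw => by simp only [hw]
  rw [this.fderiv_eq]

theorem dz_trace (hA : ∀ i j, DifferentiableAt ℝ (fun w => A w i j) z) :
    dz k (fun w => (A w).trace) z = (mdz k A z).trace := by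
  simp only [Matrix.trace, Matrix.diag]
  rw [dz_sum _ fun i _ => hA i i]
  rfl

theorem MSmoothOn.differentiableAt (hA : MSmoothOn A s) (hs : IsOpen s) (hz : z ∈ s)
    (i j : Fin n) : DifferentiableAt ℝ (fun w => A w i j) z :=
  ((hA i j).contDiffAt (hs.mem_nhds hz)).differentiableAt (by simp)

theorem MSmoothOn.mul (hA : MSmoothOn A s) (hB : MSmoothOn B s) :
    MSmoothOn (fun w => A w * B w) s := fun i j => by
  simp only [Matrix.mul_apply]
  exact ContDiffOn.sum fun l _ => (hA i l).mul (hB l j)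

theorem MSmoothOn.mdz (hA : MSmoothOn A s) (hs : IsOpen s) (k : Fin n) :
    MSmoothOn (mdz k A) s := fun i j => dz_contDiffOn hs (hA i j) k

theorem contDiffOn_det {ι : Type*} [Fintype ι] [DecidableEq ι]
    {A : (Fin n → ℂ) → Matrix ι ι ℂ} (hA : ∀ i j, ContDiffOn ℝ ∞ (fun w => A w i j) s) :
    ContDiffOn ℝ ∞ (fun w => (A w).det) s := by
  simp only [Matrix.det_apply']
  exact ContDiffOn.sum fun σ _ => contDiffOn_const.mul
    (contDiffOn_prod fun i _ => hA _ _)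

theorem MSmoothOn.inv (hA : MSmoothOn A s) (hdet : ∀ w ∈ s, (A w).det ≠ 0) :
    MSmoothOn (fun w => (A w)⁻¹) s := fun i j => by
  simp only [Matrix.inv_def, Ring.inverse_eq_inv', Matrix.smul_apply, smul_eq_mul,
    Matrix.adjugate_apply]
  refine ((contDiffOn_det hA).inv hdet).mul (contDiffOn_det fun a b => ?_)
  by_cases hab : a = j
  · subst hab
    simp only [Matrix.updateRow_self]
    exact contDiffOn_const
  · simp only [Matrix.updateRow_ne hab]
    exact hA a b

end MatrixCalculus

/-! ### The Chern connection in a chart -/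

namespace HermitianMetric

variable {n : ℕ} {M : Type*} [TopologicalSpace M] [ChartedSpace (Fin n → ℂ) M]
  [IsManifold 𝓘(ℂ, Fin n → ℂ) ω M] (T : HermitianMetric n M)
  {e : OpenPartialHomeomorph M (Fin n → ℂ)}
  (he : e ∈ atlas (Fin n → ℂ) M) {z : Fin n → ℂ} (hz : z ∈ e.target)

include he hz

open scoped ComplexOrder in
theorem gram_posDef : (gram e T.h z).PosDef := by
  rw [gram_eq he hz]
  exact gramOf_posDef _ (T.h_symm _) (T.h_pos _)

theorem gram_isHermitian : (gram e T.h z)ᴴ = gram e T.h z := by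
  rw [gram_eq he hz]
  exact gramOf_isHermitian _ (T.h_symm _)

open scoped ComplexOrder in
theorem isUnit_det_gram : IsUnit (gram e T.h z).det :=
  isUnit_iff_ne_zero.mpr (T.gram_posDef he hz).det_pos.ne'

theorem gram_mul_chern (k : Fin n) :
    gram e T.h z * chern e T.h k z = mdz k (gram e T.h) z := by
  rw [chern, Matrix.mul_nonsing_inv_cancel_left _ _ (T.isUnit_det_gram he hz)]

omit hz in
theorem chern_smooth (k : Fin n) : MSmoothOn (chern e T.h k) e.target :=
  ((T.h_smooth e he).inv fun _ hw => (T.isUnit_det_gram he hw).ne_zero).mul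
    ((T.h_smooth e he).mdz e.open_target k)

omit [IsManifold 𝓘(ℂ, Fin n → ℂ) ω M] in
theorem gram_differentiableAt (i j : Fin n) : DifferentiableAt ℝ (fun w => gram e T.h w i j) z :=
  (T.h_smooth e he).differentiableAt e.open_target hz i j

/-- The conjugate transpose of `H θ_k = ∂_k H`, with `H` Hermitian. -/
theorem mdzbar_gram (k : Fin n) :
    mdzbar k (gram e T.h) z = (chern e T.h k z)ᴴ * gram e T.h z := by
  have h1 : gram e T.h =ᶠ[nhds z] fun w => (gram e T.h w)ᴴ :=
    Filter.eventuallyEq_of_mem (e.open_target.mem_nhds hz) fun w hw =>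
      (T.gram_isHermitian he hw).symm
  rw [mdzbar_congr h1, mdzbar_conjTranspose (T.gram_differentiableAt he hz),
    ← T.gram_mul_chern he hz, Matrix.conjTranspose_mul, T.gram_isHermitian he hz]

/-- A `D'`-parallel self-adjoint endomorphism is holomorphic. -/
theorem mdzbar_eq_zero_of_covEnd_eq_zero {A : (Fin n → ℂ) → Matrix (Fin n) (Fin n) ℂ}
    (hd : ∀ i j, DifferentiableAt ℝ (fun w => A w i j) z)
    (hA : ∀ w ∈ e.target, gram e T.h w * A w = (A w)ᴴ * gram e T.h w) (k : Fin n)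
    (hc : covEnd e T.h k A z = 0) : mdzbar k A z = 0 := by
  have hg := T.gram_differentiableAt he hz
  -- `HA` is Hermitian, so `∂̄(HA) = (∂(HA))*`. Parallelism gives `∂(HA) = HAθ`, whose conjugate
  -- transpose is `θ* H A = (∂̄H) A`; the Leibniz rule leaves `H ∂̄A = 0`.
  have h1 : (fun w => gram e T.h w * A w) =ᶠ[nhds z] fun w => (gram e T.h w * A w)ᴴ :=
    Filter.eventuallyEq_of_mem (e.open_target.mem_nhds hz) fun w hw => by
      simp only [Matrix.conjTranspose_mul, T.gram_isHermitian he hw, hA w hw,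
        Matrix.conjTranspose_conjTranspose]
  have hprod : ∀ i j, DifferentiableAt ℝ (fun w => (gram e T.h w * A w) i j) z := fun i j => by
    simp only [Matrix.mul_apply]
    exact DifferentiableAt.fun_sum fun l _ => (hg i l).fun_mul (hd l j)
  have h2 : mdz k (fun w => gram e T.h w * A w) z = gram e T.h z * A z * chern e T.h k z := by
    rw [mdz_mul hg hd, ← T.gram_mul_chern he hz]
    have : mdz k A z = A z * chern e T.h k z - chern e T.h k z * A z := by
      rw [covEnd] at hc
      rw [eq_sub_iff_add_eq]
      exact sub_eq_zero.mp hc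
    rw [this]
    noncomm_ring
  have h3 := mdzbar_conjTranspose (k := k) hprod
  rw [← mdzbar_congr h1, mdzbar_mul hg hd, h2, T.mdzbar_gram he hz, Matrix.conjTranspose_mul,
    Matrix.conjTranspose_mul, T.gram_isHermitian he hz, ← hA z hz, mul_assoc, add_eq_left] at h3
  have h4 := Matrix.nonsing_inv_mul_cancel_left (gram e T.h z) (mdzbar k A z)
    (T.isUnit_det_gram he hz)
  rw [← h4, h3, mul_zero]

/-- `∂_k h(s, ∂_i) = h(D'_k s, ∂_i)`. -/
theorem dz_gram_mulVec {s : (Fin n → ℂ) → Fin n → ℂ}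
    (hs : ∀ i, DifferentiableAt ℝ (fun w => s w i) z) (k i : Fin n) :
    dz k (fun w => (gram e T.h w *ᵥ s w) i) z
      = (gram e T.h z *ᵥ fun j => dz k (fun w => s w j) z + (chern e T.h k z *ᵥ s z) j) i := by
  have hg := T.gram_differentiableAt he hz
  have h1 : (fun j => dz k (fun w => s w j) z + (chern e T.h k z *ᵥ s z) j)
      = (fun j => dz k (fun w => s w j) z) + chern e T.h k z *ᵥ s z := rfl
  rw [h1, Matrix.mulVec_add, Matrix.mulVec_mulVec, T.gram_mul_chern he hz]
  simp only [Matrix.mulVec, dotProduct, Pi.add_apply, mdz, Matrix.of_apply]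
  rw [dz_sum _ fun j _ => (hg i j).fun_mul (hs j), ← Finset.sum_add_distrib]
  refine Finset.sum_congr rfl fun j _ => ?_
  rw [dz_mul (hg i j) (hs j), add_comm]

end HermitianMetric

/-! ### Parallel fields of endomorphisms. -/

section CovEnd

variable {n : ℕ} {M : Type*} [TopologicalSpace M] [ChartedSpace (Fin n → ℂ) M]
  {e : OpenPartialHomeomorph M (Fin n → ℂ)}
  {h : ∀ x : M, HolTangent n x →ₗ[ℂ] HolTangent n x →ₗ⋆[ℂ] ℂ}
  {A B : (Fin n → ℂ) → Matrix (Fin n) (Fin n) ℂ} {z : Fin n → ℂ} {k : Fin n}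

theorem mdz_of_covEnd_eq_zero (hA : covEnd e h k A z = 0) :
    mdz k A z = A z * chern e h k z - chern e h k z * A z := by
  rw [covEnd] at hA
  rw [eq_sub_iff_add_eq]
  exact sub_eq_zero.mp hA

theorem covEnd_mul_eq_zero (hA : ∀ i j, DifferentiableAt ℝ (fun w => A w i j) z)
    (hB : ∀ i j, DifferentiableAt ℝ (fun w => B w i j) z)
    (hcA : covEnd e h k A z = 0) (hcB : covEnd e h k B z = 0) :
    covEnd e h k (fun w => A w * B w) z = 0 := by
  rw [covEnd, mdz_mul hA hB, mdz_of_covEnd_eq_zero hcA, mdz_of_covEnd_eq_zero hcB]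
  noncomm_ring

theorem covEnd_lincomb_eq_zero (hA : ∀ i j, DifferentiableAt ℝ (fun w => A w i j) z)
    (hB : ∀ i j, DifferentiableAt ℝ (fun w => B w i j) z)
    (hcA : covEnd e h k A z = 0) (hcB : covEnd e h k B z = 0) (a b c : ℂ) :
    covEnd e h k (fun w => a • A w + b • B w + c • (1 : Matrix (Fin n) (Fin n) ℂ)) z = 0 := by
  have h1 : mdz k (fun w => a • A w + b • B w + c • (1 : Matrix (Fin n) (Fin n) ℂ)) z
      = a • mdz k A z + b • mdz k B z := by
    ext i j
    simp only [mdz, Matrix.of_apply, Matrix.add_apply, Matrix.smul_apply, smul_eq_mul]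
    rw [dz_add (((hA i j).const_mul a).fun_add ((hB i j).const_mul b))
        (differentiableAt_const _), dz_add ((hA i j).const_mul a) ((hB i j).const_mul b),
      dz_mul (differentiableAt_const _) (hA i j), dz_mul (differentiableAt_const _) (hB i j),
      dz_const, dz_const, dz_const]
    ring
  rw [covEnd, h1, mdz_of_covEnd_eq_zero hcA, mdz_of_covEnd_eq_zero hcB]
  simp only [mul_add, add_mul, smul_mul_assoc, mul_smul_comm, smul_sub, mul_one, one_mul]
  abel

theorem dz_trace_eq_zero_of_covEnd_eq_zero
    (hA : ∀ i j, DifferentiableAt ℝ (fun w => A w i j) z) (hcA : covEnd e h k A z = 0) :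
    dz k (fun w => (A w).trace) z = 0 := by
  rw [dz_trace hA, mdz_of_covEnd_eq_zero hcA, Matrix.trace_sub, Matrix.trace_mul_comm, sub_self]

end CovEnd

/-! ### Pointwise consequences of the tt*-equations -/

namespace TTStarBundle

section

variable {n : ℕ} {M : Type*} [TopologicalSpace M] [ChartedSpace (Fin n → ℂ) M]
  [IsManifold 𝓘(ℂ, Fin n → ℂ) ω M] (T : TTStarBundle n M)

omit [IsManifold 𝓘(ℂ, Fin n → ℂ) ω M] in
-- Self-adjointness turns `Q* = -Q` into `h(v, Qκw + κQw) = 0` for every `v`; taking `v` to be the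
-- second argument contradicts positivity unless it vanishes.
theorem Q_κ (x : M) (w : HolTangent n x) : T.Q x (T.κ x w) = -T.κ x (T.Q x w) := by
  have : FiniteDimensional ℂ (HolTangent n x) :=
    inferInstanceAs (FiniteDimensional ℂ (Fin n → ℂ))
  rw [eq_neg_iff_add_eq_zero]
  by_contra hne
  have h1 := T.h_pos x _ hne
  have h2 := T.Q_real x (T.Q x (T.κ x w) + T.κ x (T.Q x w)) w
  rw [hermAdjoint_spec (T.h_symm x) (T.h_pos x), T.Q_selfAdjoint, ← map_add] at h2
  rw [h2] at h1
  simp at h1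

variable {e : OpenPartialHomeomorph M (Fin n → ℂ)}
  (he : e ∈ atlas (Fin n → ℂ) M) {z : Fin n → ℂ} (hz : z ∈ e.target)

include he hz

theorem gram_mul_endMat_Q :
    gram e T.h z * endMat e T.Q z = (endMat e T.Q z)ᴴ * gram e T.h z := by
  have : FiniteDimensional ℂ (HolTangent n (e.symm z)) :=
    inferInstanceAs (FiniteDimensional ℂ (Fin n → ℂ))
  rw [gram_eq he hz, endMat_eq he hz]
  refine gramOf_mul_eq_of_adjoint _ fun v w => ?_
  rw [hermAdjoint_spec (T.h_symm _) (T.h_pos _), T.Q_selfAdjoint]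

theorem gram_mul_higgsMat (k : Fin n) :
    gram e T.h z * higgsMat e T.Φ k z = (higgsAdjMat e T.h T.Φ k z)ᴴ * gram e T.h z := by
  have : FiniteDimensional ℂ (HolTangent n (e.symm z)) :=
    inferInstanceAs (FiniteDimensional ℂ (Fin n → ℂ))
  rw [gram_eq he hz, higgsMat_eq he hz, higgsAdjMat_eq he hz]
  exact gramOf_mul_eq_of_adjoint _ fun v w => hermAdjoint_spec (T.h_symm _) (T.h_pos _) _ v w

theorem antiMat_κ_mul_conj : antiMat e T.κ z * (antiMat e T.κ z).map conj = 1 := by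
  ext i j
  have h := comps_antilinear_apply he hz T.κ (T.κ _ (coordVec e z j)) i
  rw [T.κ_κ, comps_coordVec he hz] at h
  rw [Matrix.mul_apply, Matrix.one_apply, ← Pi.single_apply, h]
  rfl

theorem endMat_Q_mul_antiMat_κ :
    endMat e T.Q z * antiMat e T.κ z = -(antiMat e T.κ z * (endMat e T.Q z).map conj) := by
  ext i j
  have h1 := congrFun (comps_end_apply he hz T.Q (T.κ _ (coordVec e z j))) i
  have h2 := comps_antilinear_apply he hz T.κ (T.Q _ (coordVec e z j)) i
  rw [T.Q_κ] at h1
  have h3 : comps e z (-T.κ (e.symm z) (T.Q (e.symm z) (coordVec e z j))) i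
      = -comps e z (T.κ (e.symm z) (T.Q (e.symm z) (coordVec e z j))) i := by
    rw [← compsEquiv_apply he hz, map_neg]; rfl
  rw [h3, h2] at h1
  exact h1.symm

theorem Φ_eq_zero_of_higgsMat_eq_zero (h : ∀ k, higgsMat e T.Φ k z = 0) :
    T.Φ (e.symm z) = 0 := by
  apply (coordBasis he hz).ext
  intro k
  have h1 := h k
  rw [higgsMat_eq he hz] at h1
  rw [coordBasis_apply]
  exact (LinearMap.toMatrix (coordBasis he hz) (coordBasis he hz)).map_eq_zero_iff.mp h1

theorem higgsMat_eq_zero (h : T.Φ (e.symm z) = 0) (k : Fin n) : higgsMat e T.Φ k z = 0 := by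
  rw [higgsMat_eq he hz, h]
  simp

omit [IsManifold 𝓘(ℂ, Fin n → ℂ) ω M] in
-- The one way in which `D'(U) = 0` enters: it turns the equation for `D'(U)` into a shift relation
-- for the eigenvalues of `Q`.
theorem higgsMat_comm_Q (k : Fin n) (hU : covEnd e T.h k (endMat e T.U) z = 0) :
    higgsMat e T.Φ k z * endMat e T.Q z - endMat e T.Q z * higgsMat e T.Φ k z
      = higgsMat e T.Φ k z := by
  have h := T.D_U e he z hz k
  rw [hU, zero_sub, neg_add_eq_zero] at h
  exact h

/-- If the Chern connection is holomorphic and `D'(U) = 0`, then the Higgs field vanishes. -/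
theorem Φ_eq_zero_of_chernHolomorphic (hU : ∀ k, covEnd e T.h k (endMat e T.U) z = 0)
    (hD : ∀ k l, mdzbar l (chern e T.h k) z = 0) : T.Φ (e.symm z) = 0 := by
  refine T.Φ_eq_zero_of_higgsMat_eq_zero he hz fun k => ?_
  -- The diagonal component suffices: it says that `Φ_k` commutes with its own adjoint.
  have hc := T.curvature e he z hz k k
  rw [hD, neg_zero, zero_eq_neg, sub_eq_zero] at hc
  exact eq_zero_of_shift_of_normal (T.gram_posDef he hz) (T.gram_mul_higgsMat he hz k)
    (T.higgsMat_comm_Q he hz k (hU k)) hc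

theorem chernHolomorphic_of_Φ_eq_zero (h : T.Φ (e.symm z) = 0) (k l : Fin n) :
    mdzbar l (chern e T.h k) z = 0 := by
  have hc := T.curvature e he z hz k l
  rw [T.higgsMat_eq_zero he hz h, zero_mul, mul_zero, sub_zero, neg_zero, neg_eq_zero] at hc
  exact hc

theorem covEnd_Q_eq_zero (h : T.Φ (e.symm z) = 0) (k : Fin n) :
    covEnd e T.h k (endMat e T.Q) z = 0 := by
  have hc := T.D_Q e he z hz k
  rw [T.higgsMat_eq_zero he hz h, zero_mul, mul_zero, sub_zero, add_zero] at hc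
  exact hc

theorem hasEigenvalue_Q_iff (μ : ℂ) : (T.Q (e.symm z)).HasEigenvalue μ ↔
    (μ • (1 : Matrix (Fin n) (Fin n) ℂ) - endMat e T.Q z).det = 0 := by
  have : FiniteDimensional ℂ (HolTangent n (e.symm z)) :=
    inferInstanceAs (FiniteDimensional ℂ (Fin n → ℂ))
  have h1 : LinearMap.toMatrix (coordBasis he hz) (coordBasis he hz)
      (algebraMap ℂ (Module.End ℂ (HolTangent n (e.symm z))) μ - T.Q (e.symm z))
      = μ • (1 : Matrix (Fin n) (Fin n) ℂ) - endMat e T.Q z := by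
    rw [map_sub, ← endMat_eq, Algebra.algebraMap_eq_smul_one, map_smul, LinearMap.toMatrix_one]
  rw [← h1, LinearMap.det_toMatrix, Module.End.hasEigenvalue_iff_mem_spectrum, spectrum.mem_iff,
    LinearMap.isUnit_iff_isUnit_det, isUnit_iff_ne_zero, not_not]

theorem trace_endMat_Q : (endMat e T.Q z).trace = 0 :=
  trace_eq_zero_of_anticommute_real_structure (T.isUnit_det_gram he hz)
    (T.gram_mul_endMat_Q he hz) (T.antiMat_κ_mul_conj he hz) (T.endMat_Q_mul_antiMat_κ he hz)

end

variable {M : Type*} [TopologicalSpace M] [ChartedSpace (Fin 3 → ℂ) M]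
  [IsManifold 𝓘(ℂ, Fin 3 → ℂ) ω M] (T : TTStarBundle 3 M)
  {e : OpenPartialHomeomorph M (Fin 3 → ℂ)}
  (he : e ∈ atlas (Fin 3 → ℂ) M) {z : Fin 3 → ℂ} (hz : z ∈ e.target)

include he hz

theorem endMat_Q_pow_three :
    endMat e T.Q z ^ 3 = ((endMat e T.Q z * endMat e T.Q z).trace / 2) • endMat e T.Q z :=
  pow_three_eq_of_trace_eq_zero_of_det_eq_zero _ (T.trace_endMat_Q he hz)
    (det_eq_zero_of_anticommute_real_structure (by decide) (T.isUnit_det_gram he hz)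
      (T.gram_mul_endMat_Q he hz) (T.antiMat_κ_mul_conj he hz) (T.endMat_Q_mul_antiMat_κ he hz))

end TTStarBundle

/-! ### Flat sections of parallel line subbundles -/

/-- A closed holomorphic `1`-form on a convex open set is exact. -/
theorem exists_primitive_of_dz_symm {n : ℕ} {O : Set (Fin n → ℂ)} (hO : IsOpen O)
    (hc : Convex ℝ O) {a : Fin n → (Fin n → ℂ) → ℂ}
    (ha : ∀ z ∈ O, ∀ k, DifferentiableAt ℂ (a k) z)
    (hs : ∀ z ∈ O, ∀ k l, dz l (a k) z = dz k (a l) z) :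
    ∃ F : (Fin n → ℂ) → ℂ, ∀ z ∈ O, DifferentiableAt ℂ F z ∧ ∀ k, dz k F z = a k z := by
  let η : (Fin n → ℂ) → (Fin n → ℂ) →L[ℂ] ℂ :=
    fun z => ∑ k, a k z • (ContinuousLinearMap.proj k : (Fin n → ℂ) →L[ℂ] ℂ)
  have hη : ∀ z ∈ O, HasFDerivAt η (∑ k, (fderiv ℂ (a k) z).smulRight
      (ContinuousLinearMap.proj k : (Fin n → ℂ) →L[ℂ] ℂ)) z := fun z hz =>
    HasFDerivAt.fun_sum fun k _ => (ha z hz k).hasFDerivAt.smul_const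
      (ContinuousLinearMap.proj k : (Fin n → ℂ) →L[ℂ] ℂ)
  -- Poincaré lemma on a convex set for `η = ∑ a_k dz_k`; symmetry of the derivative of `η` is
  -- exactly `hs`.
  obtain ⟨F, hF⟩ : ∃ F, ∀ z ∈ O, HasFDerivAt F (η z) z :=
    hc.exists_forall_hasFDerivAt_of_fderiv_symmetric hO
    (fun z hz => ((hη z hz).differentiableAt.restrictScalars ℝ).differentiableWithinAt) (by
      intro z hz x y
      rw [((hη z hz).restrictScalars ℝ).fderiv]
      simp only [ContinuousLinearMap.coe_restrictScalars', sum_apply,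
        ContinuousLinearMap.smulRight_apply, smul_apply, ContinuousLinearMap.proj_apply,
        smul_eq_mul]
      have h1 (u v : Fin n → ℂ) : ∑ k, fderiv ℂ (a k) z u * v k
          = ∑ k, ∑ l, u l * v k * dz l (a k) z :=
        Finset.sum_congr rfl fun k _ => by
          rw [fderiv_complex_apply (ha z hz k), Finset.sum_mul]
          exact Finset.sum_congr rfl fun l _ => by ring
      rw [h1, h1, Finset.sum_comm]
      refine Finset.sum_congr rfl fun k _ => Finset.sum_congr rfl fun l _ => ?_
      rw [hs z hz l k, mul_comm (x k)])
  refine ⟨F, fun z hz => ⟨(hF z hz).differentiableAt, fun k => ?_⟩⟩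
  rw [dz_eq_fderiv (hF z hz).differentiableAt, (hF z hz).fderiv]
  simp [η, Pi.single_apply]

variable {n : ℕ} {M : Type*} [TopologicalSpace M] [ChartedSpace (Fin n → ℂ) M]
  [IsManifold 𝓘(ℂ, Fin n → ℂ) ω M]

/-- A nonvanishing holomorphic column of a parallel projector of rank one can be rescaled to a
flat section. -/
theorem HermitianMetric.exists_smul_flat (T : HermitianMetric n M)
    {e : OpenPartialHomeomorph M (Fin n → ℂ)} (he : e ∈ atlas (Fin n → ℂ) M)
    {O : Set (Fin n → ℂ)} (hO : IsOpen O) (hc : Convex ℝ O) (hOe : O ⊆ e.target)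
    {P : (Fin n → ℂ) → Matrix (Fin n) (Fin n) ℂ} (hPs : MSmoothOn P e.target)
    (hP : ∀ z ∈ O, ∀ i j, DifferentiableAt ℂ (fun w => P w i j) z)
    (hθ : ∀ z ∈ O, ∀ k i j, DifferentiableAt ℂ (fun w => chern e T.h k w i j) z)
    (hDP : ∀ z ∈ O, ∀ k, covEnd e T.h k P z = 0)
    (hrank : ∀ z ∈ O, ∀ i a j b, P z i a * P z j b = P z i b * P z j a)
    {i₀ j₀ i₁ : Fin n} (h₀ : ∀ z ∈ O, P z i₀ j₀ ≠ 0)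
    (h₁ : ∀ z ∈ O, (gram e T.h z *ᵥ fun i => P z i j₀) i₁ ≠ 0) :
    ∃ f : (Fin n → ℂ) → ℂ, ∀ z ∈ O, f z ≠ 0 ∧ DifferentiableAt ℂ f z ∧
      ∀ k i, dz k (fun w => f w * P w i j₀) z
        + (chern e T.h k z *ᵥ fun j => f z * P z j j₀) i = 0 := by
  set a : Fin n → (Fin n → ℂ) → ℂ := fun k z => (∑ l, P z i₀ l * chern e T.h k z l j₀) / P z i₀ j₀
    with ha_def
  have ha : ∀ z ∈ O, ∀ k, DifferentiableAt ℂ (a k) z := fun z hz k =>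
    (DifferentiableAt.fun_sum fun l _ => (hP z hz i₀ l).fun_mul (hθ z hz k l j₀)).fun_mul
      ((hP z hz i₀ j₀).fun_inv (h₀ z hz))
  -- Column `j₀` of `∂_k P + θ_k P = P θ_k` expresses `D'_k` of the column as column `j₀` of `P
  -- θ_k`. Rank one makes this a multiple of the column, with the factor `a k` read off in row `i₀`.
  have hD : ∀ z ∈ O, ∀ k i, dz k (fun w => P w i j₀) z
      + (chern e T.h k z *ᵥ fun j => P z j j₀) i = a k z * P z i j₀ := by
    intro z hz k i
    have h1 := congrFun (congrFun (mdz_of_covEnd_eq_zero (hDP z hz k)) i) j₀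
    simp only [mdz, Matrix.of_apply, Matrix.sub_apply, Matrix.mul_apply] at h1
    rw [h1, Matrix.mulVec, dotProduct, sub_add_cancel, ha_def]
    simp only
    rw [div_mul_eq_mul_div, eq_div_iff (h₀ z hz), Finset.sum_mul, Finset.sum_mul]
    refine Finset.sum_congr rfl fun l _ => ?_
    linear_combination chern e T.h k z l j₀ * hrank z hz i l i₀ j₀
  -- `b` is `h(column, ∂_{i₁})`. As `∂_{i₁}` is holomorphic, only the column is differentiated by
  -- `∂_k`, so `∂_k b = a_k b`.
  set b : (Fin n → ℂ) → ℂ := fun z => (gram e T.h z *ᵥ fun i => P z i j₀) i₁ with hb_def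
  have hbs : ContDiffOn ℝ ∞ b e.target :=
    by
    simp only [hb_def, Matrix.mulVec, dotProduct]
    exact ContDiffOn.sum fun l _ => (T.h_smooth e he i₁ l).mul (hPs l j₀)
  have hb : ∀ z ∈ O, ∀ k, dz k b z = a k z * b z := by
    intro z hz k
    rw [hb_def, T.dz_gram_mulVec he (hOe hz) fun i => (hP z hz i j₀).restrictScalars ℝ]
    simp only [hD z hz k]
    rw [show (fun j => a k z * P z j j₀) = a k z • fun j => P z j j₀ from rfl, Matrix.mulVec_smul]
    rfl
  -- The form `a` is the logarithmic `∂`-derivative of the nonvanishing smooth function `b`, so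
  -- closedness follows from `∂_k ∂_l b = ∂_l ∂_k b`.
  have hsymm : ∀ z ∈ O, ∀ k l, dz l (a k) z = dz k (a l) z := by
    intro z hz k l
    have hbz : ContDiffAt ℝ ∞ b z := hbs.contDiffAt (e.open_target.mem_nhds (hOe hz))
    have hbd : DifferentiableAt ℝ b z := hbz.differentiableAt (by simp)
    have h2 : ∀ k l, dz l (dz k b) z = dz l (a k) z * b z + a k z * (a l z * b z) := by
      intro k l
      have : dz k b =ᶠ[nhds z] fun w => a k w * b w :=
        Filter.eventuallyEq_of_mem (hO.mem_nhds hz) fun w hw => hb w hw k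
      rw [dz_congr this, dz_mul ((ha z hz k).restrictScalars ℝ) hbd, hb z hz]
    have h3 := dz_comm (hbz.of_le (by norm_cast)) l k
    rw [h2, h2] at h3
    have h4 : b z ≠ 0 := h₁ z hz
    apply mul_right_cancel₀ h4
    linear_combination h3
  obtain ⟨F, hF⟩ := exists_primitive_of_dz_symm hO hc ha hsymm
  -- With `∂_k F = a_k`, the derivative of `exp(-F)` cancels the term `a_k` in `D'_k` of the column.
  refine ⟨fun z => Complex.exp (-F z), fun z hz => ⟨Complex.exp_ne_zero _,
    (hF z hz).1.fun_neg.cexp, fun k i => ?_⟩⟩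
  have hfd : DifferentiableAt ℂ (fun w => Complex.exp (-F w)) z := (hF z hz).1.fun_neg.cexp
  have hdf : dz k (fun w => Complex.exp (-F w)) z = -(a k z * Complex.exp (-F z)) := by
    rw [dz_eq_fderiv hfd, (hF z hz).1.hasFDerivAt.fun_neg.cexp.fderiv, ← (hF z hz).2 k,
      dz_eq_fderiv (hF z hz).1]
    simp [mul_comm]
  rw [dz_mul (hfd.restrictScalars ℝ) ((hP z hz i j₀).restrictScalars ℝ), hdf,
    show (fun j => Complex.exp (-F z) * P z j j₀) = Complex.exp (-F z) • fun j => P z j j₀ from rfl,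
    Matrix.mulVec_smul, Pi.smul_apply, smul_eq_mul]
  linear_combination Complex.exp (-F z) * hD z hz k i

/-! ### Change of charts -/

section ChartChange

variable {e e' : OpenPartialHomeomorph M (Fin n → ℂ)}

/-- The coordinate vector `∂_k` of the chart `e` at the point `x`. -/
noncomputable def coordVecAt (e : OpenPartialHomeomorph M (Fin n → ℂ)) (x : M) (k : Fin n) :
    HolTangent n x :=
  (mfderiv 𝓘(ℂ, Fin n → ℂ) 𝓘(ℂ, Fin n → ℂ) e x).inverse (Pi.single k (1 : ℂ) : Fin n → ℂ)

/-- The components of a tangent vector at `x` in the chart `e`. -/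
noncomputable def compsAt (e : OpenPartialHomeomorph M (Fin n → ℂ)) (x : M) :
    HolTangent n x →ₗ[ℂ] (Fin n → ℂ) :=
  (mfderiv 𝓘(ℂ, Fin n → ℂ) 𝓘(ℂ, Fin n → ℂ) e x).toLinearMap

theorem isInvertible_mfderiv_chart (he : e ∈ atlas (Fin n → ℂ) M) {x : M} (hx : x ∈ e.source) :
    (mfderiv 𝓘(ℂ, Fin n → ℂ) 𝓘(ℂ, Fin n → ℂ) e x).IsInvertible :=
  ⟨(mdifferentiable_of_mem_atlas' he).mfderiv hx, rfl⟩

theorem coordVec_eq_coordVecAt (he : e ∈ atlas (Fin n → ℂ) M) {z : Fin n → ℂ} (hz : z ∈ e.target)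
    (k : Fin n) : coordVec e z k = coordVecAt e (e.symm z) k := by
  have h := isInvertible_mfderiv_chart he (e.map_target hz)
  apply h.injective
  exact (comps_coordVec he hz k).trans (h.self_apply_inverse _).symm

/-- Every vector-valued function of the coordinates gives a vector field. -/
theorem exists_vectorField (he : e ∈ atlas (Fin n → ℂ) M) (Y : (Fin n → ℂ) → Fin n → ℂ) :
    ∃ X : ∀ x : M, HolTangent n x, ∀ z ∈ e.target, comps e z (X (e.symm z)) = Y z := by
  refine ⟨fun x => (mfderiv 𝓘(ℂ, Fin n → ℂ) 𝓘(ℂ, Fin n → ℂ) e x).inverse (Y (e x)),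
    fun z hz => ?_⟩
  have h := (isInvertible_mfderiv_chart he (e.map_target hz)).self_apply_inverse (Y (e (e.symm z)))
  refine h.trans ?_
  rw [e.right_inv hz]

theorem transition_contDiffAt (he : e ∈ atlas (Fin n → ℂ) M) (he' : e' ∈ atlas (Fin n → ℂ) M)
    {x : M} (hx : x ∈ e.source) (hx' : x ∈ e'.source) : ContDiffAt ℂ ω (e' ∘ e.symm) (e x) := by
  have h1 : ContMDiffAt 𝓘(ℂ, Fin n → ℂ) 𝓘(ℂ, Fin n → ℂ) ω e.symm (e x) :=
    contMDiffAt_symm_of_mem_maximalAtlas (IsManifold.subset_maximalAtlas he) (e.map_source hx)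
  have h2 : ContMDiffAt 𝓘(ℂ, Fin n → ℂ) 𝓘(ℂ, Fin n → ℂ) ω e' (e.symm (e x)) :=
    contMDiffAt_of_mem_maximalAtlas (IsManifold.subset_maximalAtlas he')
      (by rwa [e.left_inv hx])
  exact (h2.comp _ h1).contDiffAt

theorem compsAt_change (he : e ∈ atlas (Fin n → ℂ) M) (he' : e' ∈ atlas (Fin n → ℂ) M)
    {x : M} (hx : x ∈ e.source) (hx' : x ∈ e'.source) (v : HolTangent n x) :
    compsAt e' x v = fderiv ℂ (e' ∘ e.symm) (e x) (compsAt e x v) := by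
  have h1 : e' =ᶠ[nhds x] (e' ∘ e.symm) ∘ e :=
    Filter.eventuallyEq_of_mem (e.open_source.mem_nhds hx) fun y hy => by
      simp only [Function.comp_apply, e.left_inv hy]
  have h2 : MDifferentiableAt 𝓘(ℂ, Fin n → ℂ) 𝓘(ℂ, Fin n → ℂ) (e' ∘ e.symm) (e x) :=
    ((transition_contDiffAt he he' hx hx').differentiableAt (by simp)).mdifferentiableAt
  have h3 := (mdifferentiable_of_mem_atlas' he).mdifferentiableAt hx
  have h4 := mfderiv_comp x h2 h3
  rw [← mfderiv_eq_fderiv]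
  exact congrArg (fun L => L v) (h1.mfderiv_eq.trans h4)

theorem compsAt_coordVecAt (he : e ∈ atlas (Fin n → ℂ) M) {x : M} (hx : x ∈ e.source)
    (k : Fin n) : compsAt e x (coordVecAt e x k) = Pi.single k 1 :=
  (isInvertible_mfderiv_chart he hx).self_apply_inverse _

theorem coordVecAt_change (he : e ∈ atlas (Fin n → ℂ) M) (he' : e' ∈ atlas (Fin n → ℂ) M)
    {x : M} (hx : x ∈ e.source) (hx' : x ∈ e'.source) (k : Fin n) :
    coordVecAt e' x k
      = ∑ l, fderiv ℂ (e ∘ e'.symm) (e' x) (Pi.single k 1) l • coordVecAt e x l := by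
  apply (isInvertible_mfderiv_chart he hx).injective
  change compsAt e x _ = compsAt e x _
  rw [compsAt_change he' he hx' hx, compsAt_coordVecAt he' hx', map_sum]
  simp only [map_smul, compsAt_coordVecAt he hx]
  ext i
  simp [Pi.single_apply]

end ChartChange

/-! ### Chart independence of flatness. -/

section FlatFrames

variable {n : ℕ} {M : Type*} [TopologicalSpace M] [ChartedSpace (Fin n → ℂ) M]
  [IsManifold 𝓘(ℂ, Fin n → ℂ) ω M] (T : HermitianMetric n M)
  {e e' : OpenPartialHomeomorph M (Fin n → ℂ)}

/-- The functions `h(∂_i, X)`, in the chart `e`. -/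
theorem h_coordVecAt_eq (he : e ∈ atlas (Fin n → ℂ) M) (X : ∀ x : M, HolTangent n x)
    {z : Fin n → ℂ} (hz : z ∈ e.target) (i : Fin n) :
    T.h (e.symm z) (coordVecAt e (e.symm z) i) (X (e.symm z))
      = conj ((gram e T.h z *ᵥ comps e z (X (e.symm z))) i) := by
  rw [← coordVec_eq_coordVecAt he hz, T.h_symm]
  congr 1
  conv_lhs => rw [← coordVec_sum_comps he hz (X (e.symm z))]
  simp [Matrix.mulVec, dotProduct, gram, mul_comm]

/-- A holomorphic vector field `X` is flat if the functions `h(∂_i, X)` are holomorphic. -/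
theorem HermitianMetric.flat_of_differentiableAt (he : e ∈ atlas (Fin n → ℂ) M)
    (X : ∀ x : M, HolTangent n x) {z : Fin n → ℂ} (hz : z ∈ e.target)
    (hX : DifferentiableAt ℂ (fun w => comps e w (X (e.symm w))) z)
    (hp : ∀ i, DifferentiableAt ℂ
      (fun w => T.h (e.symm w) (coordVecAt e (e.symm w) i) (X (e.symm w))) z) (k i : Fin n) :
    dz k (fun w => comps e w (X (e.symm w)) i) z
      + (chern e T.h k z *ᵥ comps e z (X (e.symm z))) i = 0 := by
  have hXr (i : Fin n) : DifferentiableAt ℝ (fun w => comps e w (X (e.symm w)) i) z :=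
    (differentiableAt_pi.mp hX i).restrictScalars ℝ
  have h1 : gram e T.h z *ᵥ (fun j => dz k (fun w => comps e w (X (e.symm w)) j) z
      + (chern e T.h k z *ᵥ comps e z (X (e.symm z))) j) = 0 := by
    ext i
    rw [← T.dz_gram_mulVec he hz hXr, Pi.zero_apply, ← dz_conj_eq_zero (k := k) (hp i)]
    refine dz_congr (Filter.eventuallyEq_of_mem (e.open_target.mem_nhds hz) fun w hw => ?_)
    simp only [h_coordVecAt_eq T he X hw, Complex.conj_conj]
  have h2 := congrArg ((gram e T.h z)⁻¹ *ᵥ ·) h1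
  simp only [Matrix.mulVec_mulVec, Matrix.nonsing_inv_mul _ (T.isUnit_det_gram he hz),
    Matrix.one_mulVec, Matrix.mulVec_zero] at h2
  exact congrFun h2 i

/-- The conjugates of these functions are the entries of `HX`, whose `∂_k`-derivatives are the
entries of `H D'_k X = 0`. With the converse above, flatness becomes holomorphy of functions that
change tensorially, so no transformation law for the connection matrix is needed. -/
theorem HermitianMetric.differentiableAt_of_flat (he : e ∈ atlas (Fin n → ℂ) M)
    (X : ∀ x : M, HolTangent n x) {z : Fin n → ℂ} (hz : z ∈ e.target)
    (hX : DifferentiableAt ℂ (fun w => comps e w (X (e.symm w))) z)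
    (hflat : ∀ k i, dz k (fun w => comps e w (X (e.symm w)) i) z
      + (chern e T.h k z *ᵥ comps e z (X (e.symm z))) i = 0) (i : Fin n) :
    DifferentiableAt ℂ
      (fun w => T.h (e.symm w) (coordVecAt e (e.symm w) i) (X (e.symm w))) z := by
  have hXr (i : Fin n) : DifferentiableAt ℝ (fun w => comps e w (X (e.symm w)) i) z :=
    (differentiableAt_pi.mp hX i).restrictScalars ℝ
  have h1 : DifferentiableAt ℂ
      (fun w => conj ((gram e T.h w *ᵥ comps e w (X (e.symm w))) i)) z := by
    refine differentiableAt_conj_complex_of_dz_eq_zero ?_ fun k => ?_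
    · simp only [Matrix.mulVec, dotProduct]
      exact DifferentiableAt.fun_sum fun j _ => (T.gram_differentiableAt he hz i j).fun_mul (hXr j)
    · rw [T.dz_gram_mulVec he hz hXr]
      simp only [hflat]
      exact congrFun (Matrix.mulVec_zero _) i
  exact h1.congr_of_eventuallyEq (Filter.eventuallyEq_of_mem (e.open_target.mem_nhds hz)
    fun w hw => h_coordVecAt_eq T he X hw i)

theorem differentiableAt_comps_change (he : e ∈ atlas (Fin n → ℂ) M)
    (he' : e' ∈ atlas (Fin n → ℂ) M) (X : ∀ x : M, HolTangent n x) {x : M}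
    (hx : x ∈ e.source) (hx' : x ∈ e'.source)
    (hX : DifferentiableAt ℂ (fun w => comps e w (X (e.symm w))) (e x)) :
    DifferentiableAt ℂ (fun w => comps e' w (X (e'.symm w))) (e' x) := by
  have hφ := (transition_contDiffAt he' he hx' hx).differentiableAt (by simp)
  have hψ : DifferentiableAt ℂ (fderiv ℂ (e' ∘ e.symm)) (e x) :=
    ((transition_contDiffAt he he' hx hx').fderiv_right (m := 1) le_top).differentiableAt
      one_ne_zero
  have hval : (e ∘ e'.symm) (e' x) = e x := by simp [e'.left_inv hx']
  rw [← hval] at hX hψ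
  have h := (hψ.comp (e' x) hφ).clm_apply (hX.comp (e' x) hφ)
  refine h.congr_of_eventuallyEq ?_
  have hmem : e'.target ∩ e'.symm ⁻¹' e.source ∈ nhds (e' x) :=
    (e'.isOpen_inter_preimage_symm e.open_source).mem_nhds
      ⟨e'.map_source hx', by simpa [e'.left_inv hx'] using hx⟩
  refine Filter.eventuallyEq_of_mem hmem fun w hw => ?_
  have h1 := compsAt_change he he' hw.2 (e'.map_target hw.1) (X (e'.symm w))
  refine h1.trans ?_
  -- The two base points agree only propositionally, so the equality is first generalized to a
  -- variable point and then substituted.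
  have h2 : ∀ y, y = e'.symm w → compsAt e (e'.symm w) (X (e'.symm w)) = compsAt e y (X y) := by
    rintro y rfl; rfl
  rw [h2 _ (e.left_inv hw.2)]
  rfl

/-- The `h(∂_i, X)` are linear in the coordinate vectors, so they change by the Jacobian of the
transition map, which is holomorphic. -/
theorem differentiableAt_h_change (he : e ∈ atlas (Fin n → ℂ) M)
    (he' : e' ∈ atlas (Fin n → ℂ) M) (X : ∀ x : M, HolTangent n x) {x : M}
    (hx : x ∈ e.source) (hx' : x ∈ e'.source)
    (hX : ∀ i, DifferentiableAt ℂ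
      (fun w => T.h (e.symm w) (coordVecAt e (e.symm w) i) (X (e.symm w))) (e x)) (i : Fin n) :
    DifferentiableAt ℂ
      (fun w => T.h (e'.symm w) (coordVecAt e' (e'.symm w) i) (X (e'.symm w))) (e' x) := by
  have hφ := (transition_contDiffAt he' he hx' hx).differentiableAt (by simp)
  have hφ' : DifferentiableAt ℂ (fderiv ℂ (e ∘ e'.symm)) (e' x) :=
    ((transition_contDiffAt he' he hx' hx).fderiv_right (m := 1) le_top).differentiableAt
      one_ne_zero
  have hval : (e ∘ e'.symm) (e' x) = e x := by simp [e'.left_inv hx']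
  rw [← hval] at hX
  have h : DifferentiableAt ℂ (fun w => ∑ l, fderiv ℂ (e ∘ e'.symm) w (Pi.single i 1) l *
      (fun u => T.h (e.symm u) (coordVecAt e (e.symm u) l) (X (e.symm u)))
        ((e ∘ e'.symm) w)) (e' x) :=
    DifferentiableAt.fun_sum fun l _ =>
      (differentiableAt_pi.mp (hφ'.clm_apply (differentiableAt_const _)) l).fun_mul
        ((hX l).comp (e' x) hφ)
  refine h.congr_of_eventuallyEq ?_
  have hmem : e'.target ∩ e'.symm ⁻¹' e.source ∈ nhds (e' x) :=
    (e'.isOpen_inter_preimage_symm e.open_source).mem_nhds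
      ⟨e'.map_source hx', by simpa [e'.left_inv hx'] using hx⟩
  refine Filter.eventuallyEq_of_mem hmem fun w hw => ?_
  have h2 : ∀ y l, y = e'.symm w → T.h y (coordVecAt e y l) (X y)
      = T.h (e'.symm w) (coordVecAt e (e'.symm w) l) (X (e'.symm w)) := by
    rintro y l rfl; rfl
  simp only [Function.comp_apply]
  rw [coordVecAt_change he he' hw.2 (e'.map_target hw.1)]
  simp only [h2 _ _ (e.left_inv hw.2), map_sum, map_smul, e'.right_inv hw.1,
    LinearMap.sum_apply, LinearMap.smul_apply, smul_eq_mul]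

/-- A frame that is flat and holomorphic in one chart is so in all charts. -/
theorem HermitianMetric.isFlatHolomorphicFrameOn_of_chart (he : e ∈ atlas (Fin n → ℂ) M)
    {W : Set M} (hW : W ⊆ e.source) (X : Fin n → ∀ x : M, HolTangent n x)
    (hli : ∀ x ∈ W, LinearIndependent ℂ fun j => X j x)
    (hX : ∀ x ∈ W, ∀ j, DifferentiableAt ℂ (fun w => comps e w (X j (e.symm w))) (e x))
    (hflat : ∀ x ∈ W, ∀ j k i, dz k (fun w => comps e w (X j (e.symm w)) i) (e x)
      + (chern e T.h k (e x) *ᵥ comps e (e x) (X j (e.symm (e x)))) i = 0) :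
    T.IsFlatHolomorphicFrameOn X W where
  linearIndependent := hli
  holomorphic e' he' j z hz := by
    have h := differentiableAt_comps_change he he' (X j) (hW hz.2) (e'.map_target hz.1)
      (hX _ hz.2 j)
    rw [e'.right_inv hz.1] at h
    exact h.differentiableWithinAt
  flat e' he' z hz hzW j k i := by
    have hx := hW hzW
    have hx' := e'.map_target hz
    have h1 := differentiableAt_comps_change he he' (X j) hx hx' (hX _ hzW j)
    have h2 := differentiableAt_h_change T he he' (X j) hx hx'
      (T.differentiableAt_of_flat he (X j) (e.map_source hx) (hX _ hzW j) (hflat _ hzW j))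
    rw [e'.right_inv hz] at h1 h2
    exact T.flat_of_differentiableAt he' (X j) hz h1 h2 k i

end FlatFrames

/-! ### Regular singular connections with integral eigenvalues -/

theorem hasDerivWithinAt_zpow_comp {γ : ℝ → ℂ} {γ' : ℂ} {s : Set ℝ} {t : ℝ}
    (hγ : HasDerivWithinAt γ γ' s t) (h0 : γ t ≠ 0) (m : ℤ) :
    HasDerivWithinAt (fun t => γ t ^ m) (m * γ' * (γ t)⁻¹ * γ t ^ m) s t := by
  have h := (hasDerivAt_zpow m (γ t) (Or.inl h0)).comp_hasDerivWithinAt t hγ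
  refine h.congr_deriv ?_
  rw [zpow_sub_one₀ h0]
  ring

/-- A connection `d/dz - Q/z` whose residue is diagonalizable with integral eigenvalues has
trivial monodromy. -/
theorem trivialMonodromy_of_integral_eigenbasis {n : ℕ} {V : Type*} [NormedAddCommGroup V]
    [NormedSpace ℂ V] (A : ℂ → Module.End ℂ V) (Q : Module.End ℂ V)
    (hA : ∀ z v, A z v = -(z⁻¹ • Q v)) (b : Module.Basis (Fin n) ℂ V) (m : Fin n → ℤ)
    (hQ : ∀ j, Q (b j) = (m j : ℂ) • b j) : TrivialMonodromy A := by
  have : FiniteDimensional ℂ V := b.finiteDimensional_of_finite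
  intro γ hγ hγ0 hloop
  have hγd : ∀ t ∈ Set.Icc (0 : ℝ) 1,
      HasDerivWithinAt γ (derivWithin γ (Set.Icc 0 1) t) (Set.Icc 0 1) t := fun t ht =>
    (hγ.differentiableOn one_ne_zero t ht).hasDerivWithinAt
  have h00 : γ 0 ≠ 0 := hγ0 0 (by simp)
  refine ⟨fun v => ?_, fun y hy => ?_⟩
  -- In each eigendirection the solution is `z ^ m j`, normalized to take the value `v` at `t = 0`.
  · refine ⟨fun t => ∑ j, (γ t ^ m j * (γ 0 ^ m j)⁻¹ * b.repr v j) • b j, ?_, ?_⟩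
    · intro t ht
      have h := HasDerivWithinAt.fun_sum (u := Finset.univ) fun j _ =>
        (((hasDerivWithinAt_zpow_comp (hγd t ht) (hγ0 t ht) (m j)).mul_const
          ((γ 0 ^ m j)⁻¹)).mul_const (b.repr v j)).smul_const (b j)
      refine h.congr_deriv ?_
      rw [hA, smul_neg, neg_neg, map_sum, Finset.smul_sum, Finset.smul_sum]
      refine Finset.sum_congr rfl fun j _ => ?_
      rw [map_smul, hQ, smul_smul, smul_smul, smul_smul]
      congr 1
      ring
    · conv_rhs => rw [← b.sum_repr v]
      refine Finset.sum_congr rfl fun j _ => ?_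
      rw [mul_inv_cancel₀ (zpow_ne_zero _ h00), one_mul]
  · have hy' : ∀ t ∈ Set.Icc (0 : ℝ) 1, HasDerivWithinAt y
        ((derivWithin γ (Set.Icc 0 1) t * (γ t)⁻¹) • Q (y t)) (Set.Icc 0 1) t := by
      intro t ht
      have h := hy t ht
      rw [hA, smul_neg, neg_neg, smul_smul] at h
      exact h
    have hcoord : ∀ j v, b.coord j (Q v) = m j * b.coord j v := by
      intro j v
      conv_lhs => rw [← b.sum_repr v]
      simp [-Module.Basis.sum_repr, hQ, Finsupp.single_apply, mul_comm]
    rw [Module.End.one_apply]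
    apply b.ext_elem
    intro j
    let L : V →L[ℂ] ℂ := LinearMap.toContinuousLinearMap (b.coord j)
    -- Dividing the coordinate of any parallel section by `γ ^ m j` gives a constant. As `m j` is an
    -- integer, this factor has the same value at both ends of the loop and cancels.
    have hg : ∀ t ∈ Set.Icc (0 : ℝ) 1,
        HasDerivWithinAt (fun t => γ t ^ (-m j) * L (y t)) 0 (Set.Icc 0 1) t := by
      intro t ht
      have h1 : HasDerivWithinAt (fun t => L (y t)) _ (Set.Icc 0 1) t :=
        (L.restrictScalars ℝ).hasFDerivAt.comp_hasDerivWithinAt t (hy' t ht)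
      refine ((hasDerivWithinAt_zpow_comp (hγd t ht) (hγ0 t ht) (-m j)).mul h1).congr_deriv ?_
      have h2 : L (Q (y t)) = m j * L (y t) := hcoord j (y t)
      simp only [ContinuousLinearMap.coe_restrictScalars', map_smul, smul_eq_mul, h2]
      push_cast
      ring
    have hconst := constant_of_derivWithin_zero (fun t ht => (hg t ht).differentiableWithinAt)
      (fun t ht => (hg t (Set.Ico_subset_Icc_self ht)).derivWithin
        (uniqueDiffOn_Icc one_pos t (Set.Ico_subset_Icc_self ht))) 1 (by simp)
    rw [← hloop] at hconst
    exact mul_left_cancel₀ (zpow_ne_zero _ h00) hconst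

/-- `U p = 0` removes both the `z⁻²` term and the adjoint term, leaving a simple pole with integral
residues. -/
theorem TTStarBundle.trivialMonodromy_fibreConn {M : Type*} [TopologicalSpace M]
    [ChartedSpace (Fin 3 → ℂ) M] (T : TTStarBundle 3 M) (p : M) (hU : T.U p = 0)
    (v : Fin 3 → HolTangent 3 p) (hv : LinearIndependent ℂ v)
    (hQ : ∀ j, T.Q p (v j) = (![-1, 0, 1] : Fin 3 → ℂ) j • v j) :
    TrivialMonodromy (T.fibreConn p) := by
  have : FiniteDimensional ℂ (HolTangent 3 p) :=
    inferInstanceAs (FiniteDimensional ℂ (Fin 3 → ℂ))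
  have hrank : Fintype.card (Fin 3) = Module.finrank ℂ (HolTangent 3 p) := by
    change Fintype.card (Fin 3) = Module.finrank ℂ (Fin 3 → ℂ)
    simp
  have hA : ∀ z w, T.fibreConn p z w = -(z⁻¹ • T.Q p w) := by
    intro z w
    rw [IntegrableHarmonicHiggs.fibreConn, hU, hermAdjoint_zero (T.h_symm p) (T.h_pos p)]
    simp
  let b := basisOfLinearIndependentOfCardEqFinrank hv hrank
  have hb : ∀ j, T.Q p (b j) = (((![-1, 0, 1] : Fin 3 → ℤ) j : ℤ) : ℂ) • b j := by
    intro j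
    have hj : (((![-1, 0, 1] : Fin 3 → ℤ) j : ℤ) : ℂ) = (![-1, 0, 1] : Fin 3 → ℂ) j := by
      fin_cases j <;> simp
    rw [hj, coe_basisOfLinearIndependentOfCardEqFinrank]
    exact hQ j
  -- The tangent space is definitionally the model space, which supplies the norm.
  exact trivialMonodromy_of_integral_eigenbasis (V := Fin 3 → ℂ) (T.fibreConn p) (T.Q p) hA b _ hb

/-! ### Spectral projectors -/

/-- The `2 × 2` minors of an idempotent matrix of trace one vanish. -/
theorem minors_eq_zero_of_idempotent {n : ℕ} {P : Matrix (Fin n) (Fin n) ℂ} (hP : P * P = P)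
    (ht : P.trace = 1) (i a j b : Fin n) : P i a * P j b = P i b * P j a := by
  have h1 : IsIdempotentElem (Matrix.toLin' P) := by
    rw [IsIdempotentElem, Module.End.mul_eq_comp, ← Matrix.toLin'_mul, hP]
  have h2 := (LinearMap.IsIdempotentElem.isProj_range _ h1).trace
  rw [Matrix.trace_toLin'_eq, ht] at h2
  -- The trace of an idempotent is its rank, so one vector `v` spans the range and every column is a
  -- multiple of it.
  obtain ⟨v, -, hv⟩ := finrank_eq_one_iff'.mp (by exact_mod_cast h2.symm)
  have h3 : ∀ c, ∃ t : ℂ, ∀ i, P i c = t * v.1 i := by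
    intro c
    obtain ⟨t, ht⟩ := hv ⟨Matrix.toLin' P (Pi.single c 1), LinearMap.mem_range_self _ _⟩
    refine ⟨t, fun i => ?_⟩
    have := congrFun (congrArg Subtype.val ht) i
    simpa using this.symm
  obtain ⟨s, hs⟩ := h3 a
  obtain ⟨t, ht'⟩ := h3 b
  rw [hs, ht', ht', hs]
  ring

/-- The quadratic polynomial `x A² + y A + w` in a matrix `A`. -/
noncomputable def quadMat {n : ℕ} (A : Matrix (Fin n) (Fin n) ℂ) (x y w : ℂ) :
    Matrix (Fin n) (Fin n) ℂ :=
  x • (A * A) + y • A + w • 1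

/-- If `A³ = a² A` with `tr A = 0` and `tr A² = 2 a² ≠ 0`, the eigenvalues of the `3 × 3` matrix `A`
are `-a, 0, a`, with spectral projectors quadratic in `A`. -/
theorem exists_spectral_projectors {a : ℂ} (ha : a ≠ 0) (j : Fin 3) :
    ∃ x y w : ℂ, ∀ A : Matrix (Fin 3) (Fin 3) ℂ, A ^ 3 = a ^ 2 • A → A.trace = 0 →
      (A * A).trace = 2 * a ^ 2 →
      quadMat A x y w * quadMat A x y w = quadMat A x y w ∧ (quadMat A x y w).trace = 1 ∧
      A * quadMat A x y w = (![-a, 0, a] : Fin 3 → ℂ) j • quadMat A x y w := by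
  -- The three equations before the normalization are the coefficients of `A P = μ P` after reducing
  -- `A³` to `a² A`. The normalization says the polynomial takes the value `1` at `μ`, so `P` fixes
  -- every `B` with `A B = μ B`, in particular itself.
  have key : ∀ x y w l : ℂ, l = x * a ^ 2 * 2 + w * 3 → l = 1 →
      ∀ μ : ℂ, x * a ^ 2 + w = μ * y → y = μ * x → μ * w = 0 → (x * μ ^ 2 + y * μ + w = 1) →
      ∀ A : Matrix (Fin 3) (Fin 3) ℂ, A ^ 3 = a ^ 2 • A → A.trace = 0 →
      (A * A).trace = 2 * a ^ 2 →
      quadMat A x y w * quadMat A x y w = quadMat A x y w ∧ (quadMat A x y w).trace = 1 ∧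
      A * quadMat A x y w = μ • quadMat A x y w := by
    intro x y w l hl hl1 μ h1 h2 h3 h4 A hA ht ht2
    have hA' : A * (A * A) = a ^ 2 • A := by rw [← hA]; noncomm_ring
    have hAP : A * quadMat A x y w = μ • quadMat A x y w := by
      rw [quadMat, mul_add, mul_add, mul_smul_comm, mul_smul_comm, mul_smul_comm, hA', mul_one]
      simp only [smul_add, smul_smul]
      rw [← h2, h3, ← h1, add_smul, zero_smul]
      module
    have hB : ∀ B, A * B = μ • B → quadMat A x y w * B = B := fun B hB => by
      rw [quadMat, add_mul, add_mul, smul_mul_assoc, smul_mul_assoc, smul_mul_assoc,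
        mul_assoc, hB, mul_smul_comm, hB, one_mul, smul_smul, smul_smul, smul_smul, ← add_smul,
        ← add_smul, show x * μ * μ + y * μ + w = 1 by rw [← h4]; ring, one_smul]
    refine ⟨hB _ hAP, ?_, hAP⟩
    · rw [quadMat, Matrix.trace_add, Matrix.trace_add, Matrix.trace_smul, Matrix.trace_smul,
        Matrix.trace_smul, ht, ht2, Matrix.trace_one, ← hl1, hl]
      simp
      ring
  fin_cases j
  -- The coefficients are those of the Lagrange interpolation polynomials at the nodes `-a, 0, a`.
  · exact ⟨1 / (2 * a ^ 2), -(1 / (2 * a)), 0, key _ _ _ _ rfl (by field_simp; ring) (-a)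
      (by field_simp; ring) (by field_simp) (by ring) (by field_simp; ring)⟩
  · exact ⟨-(1 / a ^ 2), 0, 1, key _ _ _ _ rfl (by field_simp; ring) 0
      (by field_simp; ring) (by ring) (by ring) (by ring)⟩
  · exact ⟨1 / (2 * a ^ 2), 1 / (2 * a), 0, key _ _ _ _ rfl (by field_simp; ring) a
      (by field_simp; ring) (by field_simp) (by ring) (by field_simp; ring)⟩

theorem injective_symmetric_triple {a : ℂ} (ha : a ≠ 0) :
    Function.Injective (![-a, 0, a] : Fin 3 → ℂ) := by
  have h1 : -a ≠ a := fun h => ha (by linear_combination (-1 / 2) * h)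
  have h2 : -a ≠ 0 := neg_ne_zero.mpr ha
  intro i j hij
  fin_cases i <;> fin_cases j <;> first
    | rfl
    | exact absurd hij h1
    | exact absurd hij h1.symm
    | exact absurd hij h2
    | exact absurd hij h2.symm
    | exact absurd hij ha
    | exact absurd hij ha.symm

/-! ### Flat eigenframes -/

section

variable {n : ℕ} {M : Type*} [TopologicalSpace M] [ChartedSpace (Fin n → ℂ) M]
  [IsManifold 𝓘(ℂ, Fin n → ℂ) ω M]

/-- The image of a parallel holomorphic projector of rank one has a flat holomorphic section
around any point. -/
theorem HermitianMetric.exists_flat_section (T : HermitianMetric n M)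
    {e : OpenPartialHomeomorph M (Fin n → ℂ)} (he : e ∈ atlas (Fin n → ℂ) M)
    {z₀ : Fin n → ℂ} {ρ : ℝ} (hρ : 0 < ρ) (hρe : Metric.ball z₀ ρ ⊆ e.target)
    {P : (Fin n → ℂ) → Matrix (Fin n) (Fin n) ℂ} (hPs : MSmoothOn P e.target)
    (hP : ∀ z ∈ Metric.ball z₀ ρ, ∀ i j, DifferentiableAt ℂ (fun w => P w i j) z)
    (hθ : ∀ z ∈ Metric.ball z₀ ρ, ∀ k i j, DifferentiableAt ℂ (fun w => chern e T.h k w i j) z)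
    (hDP : ∀ z ∈ Metric.ball z₀ ρ, ∀ k, covEnd e T.h k P z = 0)
    (hPP : ∀ z ∈ Metric.ball z₀ ρ, P z * P z = P z)
    (htr : ∀ z ∈ Metric.ball z₀ ρ, (P z).trace = 1) :
    ∃ r, 0 < r ∧ r ≤ ρ ∧ ∃ Y : (Fin n → ℂ) → Fin n → ℂ, ∀ z ∈ Metric.ball z₀ r, Y z ≠ 0 ∧
      DifferentiableAt ℂ Y z ∧ (∃ w, Y z = P z *ᵥ w) ∧
      ∀ k i, dz k (fun w => Y w i) z + (chern e T.h k z *ᵥ Y z) i = 0 := by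
  have hz₀ := Metric.mem_ball_self (x := z₀) hρ
  obtain ⟨i₀, j₀, h₀⟩ : ∃ i₀ j₀, P z₀ i₀ j₀ ≠ 0 := by
    by_contra! h
    have h1 : P z₀ = 0 := by ext i j; exact h i j
    have h2 := htr z₀ hz₀
    simp [h1] at h2
  -- Invertibility of the Gram matrix lets some coordinate vector pair nontrivially with the nonzero
  -- column; by continuity both conditions persist on a smaller ball.
  obtain ⟨i₁, h₁⟩ : ∃ i₁, (gram e T.h z₀ *ᵥ fun i => P z₀ i j₀) i₁ ≠ 0 := by
    by_contra! h
    have h1 : gram e T.h z₀ *ᵥ (fun i => P z₀ i j₀) = 0 := funext h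
    have h2 := congrArg ((gram e T.h z₀)⁻¹ *ᵥ ·) h1
    simp only [Matrix.mulVec_mulVec, Matrix.nonsing_inv_mul _ (T.isUnit_det_gram he (hρe hz₀)),
      Matrix.one_mulVec, Matrix.mulVec_zero] at h2
    exact h₀ (congrFun h2 i₀)
  have c₀ : ContinuousAt (fun z => P z i₀ j₀) z₀ := (hP z₀ hz₀ i₀ j₀).continuousAt
  have c₁ : ContinuousAt (fun z => (gram e T.h z *ᵥ fun i => P z i j₀) i₁) z₀ := by
    have : DifferentiableAt ℝ (fun z => ∑ l, gram e T.h z i₁ l * P z l j₀) z₀ :=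
      DifferentiableAt.fun_sum fun l _ => (T.gram_differentiableAt he (hρe hz₀) i₁ l).fun_mul
        ((hP z₀ hz₀ l j₀).restrictScalars ℝ)
    exact this.continuousAt
  obtain ⟨r, hr, hball⟩ := Metric.eventually_nhds_iff_ball.mp
    ((c₀.eventually_ne h₀).and (c₁.eventually_ne h₁))
  have hsub : Metric.ball z₀ (min r ρ) ⊆ Metric.ball z₀ ρ :=
    Metric.ball_subset_ball (min_le_right _ _)
  have hsub' : Metric.ball z₀ (min r ρ) ⊆ Metric.ball z₀ r :=
    Metric.ball_subset_ball (min_le_left _ _)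
  obtain ⟨f, hf⟩ := T.exists_smul_flat he (Metric.isOpen_ball (x := z₀) (ε := min r ρ))
    (convex_ball _ _) (hsub.trans hρe) hPs (fun z hz => hP z (hsub hz)) (fun z hz => hθ z (hsub hz))
    (fun z hz => hDP z (hsub hz))
    (fun z hz => minors_eq_zero_of_idempotent (hPP z (hsub hz)) (htr z (hsub hz)))
    (fun z hz => (hball z (hsub' hz)).1) (fun z hz => (hball z (hsub' hz)).2)
  refine ⟨min r ρ, lt_min hr hρ, min_le_right _ _, fun z i => f z * P z i j₀, fun z hz => ?_⟩
  obtain ⟨hf0, hfd, hfl⟩ := hf z hz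
  refine ⟨fun h => mul_ne_zero hf0 (hball z (hsub' hz)).1 (congrFun h i₀),
    differentiableAt_pi.mpr fun i => hfd.fun_mul (hP z (hsub hz) i j₀),
    ⟨Pi.single j₀ (f z), ?_⟩, hfl⟩
  ext i
  simp [mul_comm]

end

section

variable {M : Type*} [TopologicalSpace M] [ChartedSpace (Fin 3 → ℂ) M]
  [IsManifold 𝓘(ℂ, Fin 3 → ℂ) ω M] (T : TTStarBundle 3 M)
  {e : OpenPartialHomeomorph M (Fin 3 → ℂ)}

/-- With `Φ = 0`, `Q` is parallel and holomorphic. Only `a²` enters the cubic relation, so either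
sign of eigenvalue at `p` determines the whole spectrum nearby. -/
theorem TTStarBundle.exists_flat_eigenframe (he : e ∈ atlas (Fin 3 → ℂ) M)
    (hΦ : ∀ z ∈ e.target, T.Φ (e.symm z) = 0) {p : M} (hp : p ∈ e.source) {a : ℂ} (ha : a ≠ 0)
    (hev : (T.Q p).HasEigenvalue a ∨ (T.Q p).HasEigenvalue (-a)) :
    ∃ W ⊆ e.source, IsOpen W ∧ p ∈ W ∧ ∃ X : Fin 3 → ∀ x : M, HolTangent 3 x,
      T.IsFlatHolomorphicFrameOn X W ∧
      ∀ x ∈ W, ∀ j, T.Q x (X j x) = (![-a, 0, a] : Fin 3 → ℂ) j • X j x := by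
  set A := endMat e T.Q with hA_def
  have hAs : MSmoothOn A e.target := T.Q_smooth e he
  have hAr : ∀ z ∈ e.target, ∀ i j, DifferentiableAt ℝ (fun w => A w i j) z := fun z hz =>
    hAs.differentiableAt e.open_target hz
  have hcov : ∀ z ∈ e.target, ∀ k, covEnd e T.h k A z = 0 := fun z hz =>
    T.covEnd_Q_eq_zero he hz (hΦ z hz)
  have hAd : ∀ z ∈ e.target, ∀ i j, DifferentiableAt ℂ (fun w => A w i j) z := fun z hz i j =>
    differentiableAt_complex_of_dzbar_eq_zero (hAr z hz i j) fun k =>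
      congrFun (congrFun (T.mdzbar_eq_zero_of_covEnd_eq_zero he hz (hAr z hz)
        (fun w hw => T.gram_mul_endMat_Q he hw) k (hcov z hz k)) i) j
  have hθ : ∀ z ∈ e.target, ∀ k i j, DifferentiableAt ℂ (fun w => chern e T.h k w i j) z :=
    fun z hz k i j => differentiableAt_complex_of_dzbar_eq_zero
      ((T.chern_smooth he k).differentiableAt e.open_target hz i j) fun l =>
      congrFun (congrFun (T.chernHolomorphic_of_Φ_eq_zero he hz (hΦ z hz) k l) i) j
  have hA2r : ∀ z ∈ e.target, ∀ i j, DifferentiableAt ℝ (fun w => (A w * A w) i j) z :=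
    fun z hz => (hAs.mul hAs).differentiableAt e.open_target hz
  have hA2d : ∀ z ∈ e.target, ∀ i j, DifferentiableAt ℂ (fun w => (A w * A w) i j) z :=
    fun z hz i j => by
      simp only [Matrix.mul_apply]
      exact DifferentiableAt.fun_sum fun l _ => (hAd z hz i l).fun_mul (hAd z hz l j)
  have hcov2 : ∀ z ∈ e.target, ∀ k, covEnd e T.h k (fun w => A w * A w) z = 0 := fun z hz k =>
    covEnd_mul_eq_zero (hAr z hz) (hAr z hz) (hcov z hz k) (hcov z hz k)
  have hz₀ : e p ∈ e.target := e.map_source hp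
  obtain ⟨ρ, hρ, hρe⟩ := Metric.isOpen_iff.mp e.open_target _ hz₀
  -- Applying the cubic relation to an eigenvector gives `μ³ = (tr Q² / 2) μ`, and `μ ≠ 0` can be
  -- cancelled.
  have htr₀ : (A (e p) * A (e p)).trace = 2 * a ^ 2 := by
    obtain ⟨μ, hμ, hμa⟩ : ∃ μ, (T.Q p).HasEigenvalue μ ∧ μ ^ 2 = a ^ 2 :=
      hev.elim (fun h => ⟨a, h, rfl⟩) fun h => ⟨-a, h, by ring⟩
    have hμ0 : μ ≠ 0 := fun h => ha (by rw [h] at hμa; simpa using hμa.symm)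
    have h1 : (T.Q (e.symm (e p))).HasEigenvalue μ := by rwa [e.left_inv hp]
    rw [T.hasEigenvalue_Q_iff he hz₀] at h1
    obtain ⟨v, hv, hv0⟩ := Matrix.exists_mulVec_eq_zero_iff.mpr h1
    have h2 : A (e p) *ᵥ v = μ • v := by
      rw [Matrix.sub_mulVec, Matrix.smul_mulVec, Matrix.one_mulVec, sub_eq_zero] at hv0
      exact hv0.symm
    have h3 := congrArg (· *ᵥ v) (T.endMat_Q_pow_three he hz₀)
    simp only [← hA_def, pow_succ, pow_zero, one_mul, ← Matrix.mulVec_mulVec, h2,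
      Matrix.mulVec_smul, Matrix.smul_mulVec, smul_smul] at h3
    obtain ⟨i, hi⟩ := Function.ne_iff.mp hv
    have h4 := congrFun h3 i
    simp only [Pi.smul_apply, smul_eq_mul] at h4
    have h5 := mul_right_cancel₀ hi h4
    have h6 : μ * μ = (A (e p) * A (e p)).trace / 2 := 
      mul_right_cancel₀ hμ0 (by linear_combination h5)
    rw [← hμa]
    linear_combination -2 * h6
  have htrd : ∀ z ∈ e.target, DifferentiableAt ℂ (fun w => (A w * A w).trace) z := fun z hz => by
    simp only [Matrix.trace, Matrix.diag]
    exact DifferentiableAt.fun_sum fun i _ => hA2d z hz i i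
  -- `tr Q²` is holomorphic, and its `∂_k` are traces of commutators, so it is constant on the
  -- convex ball.
  have htr : ∀ z ∈ Metric.ball (e p) ρ, (A z * A z).trace = 2 * a ^ 2 := by
    intro z hz
    rw [← htr₀]
    refine (convex_ball (e p) ρ).is_const_of_fderivWithin_eq_zero (𝕜 := ℂ)
      (f := fun w => (A w * A w).trace)
      (fun w hw => (htrd w (hρe hw)).differentiableWithinAt) (fun w hw => ?_) hz
      (Metric.mem_ball_self hρ)
    rw [fderivWithin_of_isOpen Metric.isOpen_ball hw]
    ext v
    rw [fderiv_complex_apply (htrd w (hρe hw))]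
    simp [dz_trace_eq_zero_of_covEnd_eq_zero (hA2r w (hρe hw)) (hcov2 w (hρe hw) _)]
  have hcube : ∀ z ∈ Metric.ball (e p) ρ, A z ^ 3 = a ^ 2 • A z := fun z hz => by
    rw [T.endMat_Q_pow_three he (hρe hz), ← hA_def, htr z hz]
    congr 1
    ring
  have hsec : ∀ j : Fin 3, ∃ r, 0 < r ∧ r ≤ ρ ∧ ∃ Y : (Fin 3 → ℂ) → Fin 3 → ℂ,
      ∀ z ∈ Metric.ball (e p) r, Y z ≠ 0 ∧ DifferentiableAt ℂ Y z ∧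
      A z *ᵥ Y z = (![-a, 0, a] : Fin 3 → ℂ) j • Y z ∧
      ∀ k i, dz k (fun w => Y w i) z + (chern e T.h k z *ᵥ Y z) i = 0 := by
    intro j
    obtain ⟨x, y, w, hP⟩ := exists_spectral_projectors ha j
    have hP' : ∀ z ∈ Metric.ball (e p) ρ, _ := fun z hz =>
      hP (A z) (hcube z hz) (T.trace_endMat_Q he (hρe hz)) (htr z hz)
    obtain ⟨r, hr, hrρ, Y, hY⟩ := T.exists_flat_section he hρ hρe
      (P := fun z => quadMat (A z) x y w)
      (fun i j => ((contDiffOn_const.mul ((hAs.mul hAs) i j)).add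
        (contDiffOn_const.mul (hAs i j))).add contDiffOn_const)
      (fun z hz i j => (((hA2d z (hρe hz) i j).const_mul x).add
        ((hAd z (hρe hz) i j).const_mul y)).add (differentiableAt_const _))
      (fun z hz => hθ z (hρe hz))
      (fun z hz k => covEnd_lincomb_eq_zero (hA2r z (hρe hz)) (hAr z (hρe hz))
        (hcov2 z (hρe hz) k) (hcov z (hρe hz) k) x y w)
      (fun z hz => (hP' z hz).1) (fun z hz => (hP' z hz).2.1)
    refine ⟨r, hr, hrρ, Y, fun z hz => ?_⟩
    obtain ⟨h1, h2, ⟨u, hu⟩, h3⟩ := hY z hz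
    refine ⟨h1, h2, ?_, h3⟩
    rw [hu, Matrix.mulVec_mulVec, (hP' z (Metric.ball_subset_ball hrρ hz)).2.2, Matrix.smul_mulVec]
  choose r hr hrρ Y hY using hsec
  choose X hX using fun j => exists_vectorField he (Y j)
  set R := min (r 0) (min (r 1) (r 2)) with hR
  have hR0 : 0 < R := lt_min (hr 0) (lt_min (hr 1) (hr 2))
  have hRr : ∀ j, R ≤ r j := by
    intro j
    fin_cases j <;> simp [hR]
  set W := e.source ∩ e ⁻¹' Metric.ball (e p) R with hW
  have hWz : ∀ x ∈ W, ∃ z ∈ e.target, z ∈ Metric.ball (e p) R ∧ e.symm z = x := fun x hx =>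
    ⟨e x, e.map_source hx.1, hx.2, e.left_inv hx.1⟩
  have hY' : ∀ z ∈ Metric.ball (e p) R, ∀ j, _ := fun z hz j =>
    hY j z (Metric.ball_subset_ball (hRr j) hz)
  have heig : ∀ x ∈ W, ∀ j, T.Q x (X j x) = (![-a, 0, a] : Fin 3 → ℂ) j • X j x := by
    intro x hx j
    obtain ⟨z, hz, hzb, rfl⟩ := hWz x hx
    apply (compsEquiv he hz).injective
    rw [map_smul, compsEquiv_apply, compsEquiv_apply, comps_end_apply he hz, hX j z hz]
    exact (hY' z hzb j).2.2.1
  have hne : ∀ x ∈ W, ∀ j, X j x ≠ 0 := by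
    intro x hx j h0
    obtain ⟨z, hz, hzb, rfl⟩ := hWz x hx
    apply (hY' z hzb j).1
    rw [← hX j z hz, h0, ← compsEquiv_apply he hz, map_zero]
  have hev (j : Fin 3) : ∀ z ∈ e.target,
      (fun w => comps e w (X j (e.symm w))) =ᶠ[nhds z] Y j := fun z hz =>
    Filter.eventuallyEq_of_mem (e.open_target.mem_nhds hz) fun w hw => hX j w hw
  refine ⟨W, Set.inter_subset_left, e.isOpen_inter_preimage Metric.isOpen_ball,
    ⟨hp, Metric.mem_ball_self hR0⟩, X, ?_, heig⟩
  refine T.isFlatHolomorphicFrameOn_of_chart he Set.inter_subset_left X (fun x hx => ?_)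
    (fun x hx j => ?_) (fun x hx j k i => ?_)
  · exact Module.End.eigenvectors_linearIndependent' (T.Q x) _
      (injective_symmetric_triple ha) _ fun j =>
      ⟨Module.End.mem_eigenspace_iff.mpr (heig x hx j), hne x hx j⟩
  · exact (hY' _ hx.2 j).2.1.congr_of_eventuallyEq (hev j _ (e.map_source hx.1))
  · have h1 : (fun w => comps e w (X j (e.symm w)) i) =ᶠ[nhds (e x)] fun w => Y j w i :=
      (hev j _ (e.map_source hx.1)).mono fun w hw => congrFun hw i
    rw [dz_congr h1, hX j _ (e.map_source hx.1)]
    exact (hY' _ hx.2 j).2.2.2 k i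

/-- If none of `1, -1, -1/2` is an eigenvalue of `Q` at `p` and `D'(U) = 0`, then the Higgs field
vanishes around `p`. -/
theorem TTStarBundle.exists_isOpen_Φ_eq_zero
    (hU : ∀ e ∈ atlas (Fin 3 → ℂ) M, ∀ z ∈ e.target, ∀ k, covEnd e T.h k (endMat e T.U) z = 0)
    (p : M) (h1 : ¬ (T.Q p).HasEigenvalue 1) (h2 : ¬ (T.Q p).HasEigenvalue (-1))
    (h3 : ¬ (T.Q p).HasEigenvalue (-1 / 2)) :
    ∃ W : Set M, IsOpen W ∧ p ∈ W ∧ ∀ x ∈ W, T.Φ x = 0 := by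
  set e := chartAt (Fin 3 → ℂ) p
  have he : e ∈ atlas (Fin 3 → ℂ) M := chart_mem_atlas _ p
  have hp : p ∈ e.source := mem_chart_source _ p
  have hp' := e.map_source hp
  -- The characteristic polynomial at a fixed `μ` is continuous in the point, so not having `μ` as
  -- an eigenvalue is an open condition.
  let d : ℂ → (Fin 3 → ℂ) → ℂ := fun μ z =>
    (μ • (1 : Matrix (Fin 3) (Fin 3) ℂ) - endMat e T.Q z).det
  have hd (μ : ℂ) : IsOpen (e.source ∩ e ⁻¹' (e.target ∩ d μ ⁻¹' {0}ᶜ)) := by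
    refine e.isOpen_inter_preimage (ContinuousOn.isOpen_inter_preimage ?_ e.open_target
      isOpen_compl_singleton)
    exact (contDiffOn_det fun i j =>
      contDiffOn_const.sub (T.Q_smooth e he i j)).continuousOn
  have hdp {μ : ℂ} (h : ¬ (T.Q p).HasEigenvalue μ) :
      p ∈ e.source ∩ e ⁻¹' (e.target ∩ d μ ⁻¹' {0}ᶜ) := by
    refine ⟨hp, hp', fun h0 => h ?_⟩
    have := (T.hasEigenvalue_Q_iff he hp' μ).mpr h0
    rwa [e.left_inv hp] at this
  refine ⟨_, ((hd 1).inter (hd (-1))).inter (hd (-1 / 2)), ⟨⟨hdp h1, hdp h2⟩, hdp h3⟩, ?_⟩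
  rintro x ⟨⟨⟨hx, hx', hx1⟩, -, -, hx2⟩, -, -, hx3⟩
  rw [← e.left_inv hx]
  exact T.Φ_eq_zero_of_higgsMat_eq_zero he hx' fun k =>
    eq_zero_of_shift_of_pow_three (T.endMat_Q_pow_three he hx')
      (T.higgsMat_comm_Q he hx' k (hU e he _ hx' k)) hx1 hx2 hx3

end

end TTStar

theorem mainTheorem4 {M : Type*} [TopologicalSpace M] [ChartedSpace (Fin 3 → ℂ) M]
    [IsManifold 𝓘(ℂ, Fin 3 → ℂ) ω M] (T : TTStar.TTStarBundle 3 M)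
    (hU : ∀ e ∈ atlas (Fin 3 → ℂ) M, ∀ z ∈ e.target, ∀ k,
      TTStar.covEnd e T.h k (TTStar.endMat e T.U) z = 0)
    (p : M) :
    ((∀ μ ∈ ({1, -1, 1 / 2, -1 / 2} : Set ℂ), ¬ (T.Q p).HasEigenvalue μ) →
      ∃ W : Set M, IsOpen W ∧ p ∈ W ∧ (∀ x ∈ W, T.Φ x = 0) ∧ T.ChernHolomorphicOn W) ∧
    ((∃ μ ∈ ({1, -1, 1 / 2, -1 / 2} : Set ℂ), (T.Q p).HasEigenvalue μ) →
      T.ChernHolomorphicOn Set.univ →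
      ∃ W : Set M, IsOpen W ∧ p ∈ W ∧ (∀ x ∈ W, T.Φ x = 0) ∧
        ∃ X : Fin 3 → ∀ x : M, TTStar.HolTangent 3 x, T.IsFlatHolomorphicFrameOn X W ∧
          ((∀ x ∈ W, ∀ j, T.Q x (X j x) = (![-1, 0, 1] : Fin 3 → ℂ) j • X j x) ∨
            (∀ x ∈ W, ∀ j, T.Q x (X j x) = (![-1 / 2, 0, 1 / 2] : Fin 3 → ℂ) j • X j x))) ∧
    (∀ (W : Set M) (X : Fin 3 → ∀ x : M, TTStar.HolTangent 3 x), IsOpen W → p ∈ W →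
      T.IsFlatHolomorphicFrameOn X W →
      (∀ x ∈ W, ∀ j, T.Q x (X j x) = (![-1, 0, 1] : Fin 3 → ℂ) j • X j x) →
      T.U p = 0 → TTStar.TrivialMonodromy (T.fibreConn p)) := by
  refine ⟨fun hev => ?_, fun hev hD => ?_, fun W X _ hpW hX hQ hUp => ?_⟩
  · obtain ⟨W, hW, hpW, hΦ⟩ := T.exists_isOpen_Φ_eq_zero hU p (hev _ (by simp)) (hev _ (by simp))
      (hev _ (by simp))
    exact ⟨W, hW, hpW, hΦ, fun e he z hz hzW k l =>
      T.chernHolomorphic_of_Φ_eq_zero he hz (hΦ _ hzW) k l⟩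
  · have he := chart_mem_atlas (Fin 3 → ℂ) p
    have hp := mem_chart_source (Fin 3 → ℂ) p
    -- Holomorphy of `D'` kills `Φ` on the whole chart domain; the eigenvalue condition at `p` then
    -- only selects `a = 1` or `a = 1/2`.
    have hΦ : ∀ z ∈ (chartAt (Fin 3 → ℂ) p).target, T.Φ ((chartAt (Fin 3 → ℂ) p).symm z) = 0 :=
      fun z hz => T.Φ_eq_zero_of_chernHolomorphic he hz (hU _ he z hz)
        fun k l => hD _ he z hz (Set.mem_univ _) k l
    have hΦ' : ∀ W ⊆ (chartAt (Fin 3 → ℂ) p).source, ∀ x ∈ W, T.Φ x = 0 := fun W hW x hx => by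
      rw [← (chartAt (Fin 3 → ℂ) p).left_inv (hW hx)]
      exact hΦ _ ((chartAt (Fin 3 → ℂ) p).map_source (hW hx))
    have hev' : ((T.Q p).HasEigenvalue 1 ∨ (T.Q p).HasEigenvalue (-1)) ∨
        ((T.Q p).HasEigenvalue (1 / 2) ∨ (T.Q p).HasEigenvalue (-(1 / 2))) := by
      obtain ⟨μ, rfl | rfl | rfl | rfl, h⟩ := hev
      · exact Or.inl (Or.inl h)
      · exact Or.inl (Or.inr h)
      · exact Or.inr (Or.inl h)
      · exact Or.inr (Or.inr (by rwa [neg_div] at h))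
    rcases hev' with h | h
    · obtain ⟨W, hWs, hW, hpW, X, hX, hQ⟩ := T.exists_flat_eigenframe he hΦ hp one_ne_zero h
      exact ⟨W, hW, hpW, hΦ' W hWs, X, hX, Or.inl hQ⟩
    · obtain ⟨W, hWs, hW, hpW, X, hX, hQ⟩ :=
        T.exists_flat_eigenframe he hΦ hp (one_div_ne_zero two_ne_zero) h
      refine ⟨W, hW, hpW, hΦ' W hWs, X, hX, Or.inr ?_⟩
      rw [neg_div]
      exact hQ
  · exact T.trivialMonodromy_fibreConn p hUp (fun j => X j p) (hX.linearIndependent p hpW)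
      (hQ p hpW)
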